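/- Let $n\ge 1$. Equip $\mathbb Q^{2n}\supset\mathbb Z^{2n}$ with the standard symplectic form $\omega$ (symplectic basis $\vec e_1,\vec f_1,\dots,\vec e_n,\vec f_n$, $\omega(\vec e_i,\vec f_i)=1$). Let $T^\omega_n$ be the poset of non-zero isotropic subspaces of $\mathbb Q^{2n}$ ordered by inclusion and $\mathrm{St}^\omega_n=\tilde H_{n-1}(T^\omega_n;\mathbb Z)$ the reduced homology of its order complex. All homology is simplicial with $\mathbb Z$-coefficients. *The complexes $\mathcal I_n^\delta\subset\mathcal{IA}_n$.* Their vertices are the rank-1 summands $v$ of $\mathbb Z^{2n}$; write $\vec v$ for a generator of $v$. A set $\{v_0,\dots,v_k\}$ of $k+1$ such lines is called - *standard* if $\langle \vec v_0,\dots,\vec v_k\rangle$ is an isotropic summand of $\mathbb Z^{2n}$ of rank $k+1$; - *2-additive* if (for a suitable labelling) $\vec v_0=\pm\vec v_1\pm\vec v_2$ and $\{v_1,\dots,v_k\}$ is standard; - a *$\sigma$ simplex* if $k \geq 1$ and (for a suitable labelling) $\omega(\vec v_k,\vec v_{k-1})=\pm1$, $\omega(\vec v_k,\vec v_i)=0$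 for $i\le k-2$, and $\{v_0,\dots,v_{k-1}\}$ is standard; the edge $\{v_{k-1},v_k\}$ is its $\sigma$ edge; - *mixed* if $k\ge 4$ and, for a suitable labelling, omitting $v_0$ gives a $\sigma$ simplex with $\sigma$ edge $\{v_{k-1},v_k\}$ and omitting $v_k$ gives a 2-additive simplex with $\vec v_0=\pm\vec v_1\pm\vec v_2$. The simplices of $\mathcal I_n^\delta$ are the standard and the 2-additive ones; those of $\mathcal{IA}_n$ are the standard, 2-additive, $\sigma$ and mixed ones. *The model disc.* Let $\partial\beta_n$ be the simplicial complex on the vertex set $\{1,\bar 1,\dots,n,\bar n\}$ whose simplices are the non-empty subsets containing no pair $\{a,\bar a\}$, and let $\beta_n\supset\partial\beta_n$ have as additional simplices the subsets that contain $\{n,\bar n\}$ and no other such pair. Fix a generator $\xi_0\in\tilde H_0(\partial\beta_1)\cong\mathbb Z$ and let $\xi=\xi_{n-1}\in\tilde H_{n-1}(\partial\beta_n)$ be obtained from it by the iterated suspension isomorphism ($\partial\beta_{n}=\partial\beta_{n-1}*\{n,\bar n\}$). The connecting morphism $H_n(\beta_n,\partial\beta_n)\to\tilde H_{n-1}(\partial\beta_n)$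 is an isomorphism; the fundamental class of $(\beta_n,\partial\beta_n)$ is the preimage of $\xi$. *The maps.* For a simplicial complex $X$ let $P(X)$ be its poset of simplices (identified with its order complex in homology) and $b:\tilde H_{*}(X)\to\tilde H_{*}(P(X))$ the map induced by barycentric subdivision of chains. For $M\in\mathrm{Sp}_{2n}(\mathbb Z)$ let $(\vec M_a)_{a\in\{1,\bar1,\dots,n,\bar n\}}$ be its columns, where $\vec M_i = M\vec e_i$ and $\vec M_{\bar i}=M\vec f_i$. - The integral apartment class map is the homomorphism $[-]:\mathbb Z[\mathrm{Sp}_{2n}(\mathbb Z)]\to\mathrm{St}^\omega_n$ with $[M]=\partial M_\star(b(\xi))$, where $\partial M:P(\partial\beta_n)\to T^\omega_n$, $I\mapsto\langle\vec M_a:a\in I\rangle_{\mathbb Q}$. - $\alpha:\mathbb Z[\mathrm{Sp}_{2n}(\mathbb Z)]\to H_n(\mathcal{IA}_n,\mathcal I_n^\delta)$ is the homomorphism that sends $M$ to the image of the fundamental class of $(\beta_n,\partial\beta_n)$ under the simplicial map of pairs $(\beta_n,\partial\beta_n)\to(\mathcal{IA}_n,\mathcal I_n^\delta)$, $a\mapsto\langle\vec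 M_a\rangle_{\mathbb Z}$. - $\delta:H_n(\mathcal{IA}_n,\mathcal I_n^\delta)\to\tilde H_{n-1}(\mathcal I_n^\delta)$ is the connecting morphism of the pair. - $s_\star:\tilde H_{n-1}(P(\mathcal I_n^\delta))\to\mathrm{St}^\omega_n$ is induced by the poset map $\Delta\mapsto\langle\Delta\rangle_{\mathbb Q}$. **Proposition.** The map $b:\tilde H_{n-1}(\mathcal I_n^\delta)\to\tilde H_{n-1}(P(\mathcal I_n^\delta))$ is an isomorphism, and the integral apartment class map factors as $$[-]=s_\star\circ b\circ\delta\circ\alpha .$$ -/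

import Mathlib

noncomputable section

namespace SymplecticApartments

/-! ### Simplicial homology

Simplicial complexes are Mathlib's `AbstractSimplicialComplex`. Homology is computed from ordered
chains: the generators are the tuples of vertices (repetitions allowed) whose entries span a
simplex. The complex is augmented and indexed by the number of entries of a tuple, so that index
`k` is degree `k - 1`. -/

/-- Integral linear combinations of `k`-tuples of vertices. -/
abbrev Chains (ι : Type*) (k : ℕ) : Type _ := (Fin k → ι) →₀ ℤ

/-- The simplicial boundary: it sends a tuple to the alternating sum of the tuples in which one
entry is omitted; in particular a one-entry tuple is sent to the empty tuple (augmentation). -/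
def bdry {ι : Type*} (k : ℕ) : Chains ι (k + 1) →ₗ[ℤ] Chains ι k :=
  Finsupp.linearCombination ℤ fun t : Fin (k + 1) → ι =>
    ∑ i : Fin (k + 1), Finsupp.single (fun j : Fin k => t (i.succAbove j)) ((-1 : ℤ) ^ (i : ℕ))

/-- Putting the vertex `a` in front of every tuple. -/
def cone {ι : Type*} (a : ι) (k : ℕ) : Chains ι k →ₗ[ℤ] Chains ι (k + 1) :=
  Finsupp.lmapDomain ℤ ℤ fun t => (Fin.cons a t : Fin (k + 1) → ι)

/-- The linear map on chains induced by a map of vertices. -/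
def push {ι κ : Type*} (f : ι → κ) (k : ℕ) : Chains ι k →ₗ[ℤ] Chains κ k :=
  Finsupp.lmapDomain ℤ ℤ fun t => f ∘ t

section
variable {ι κ : Type*}

theorem chains_hom_ext {M : Type*} [AddCommGroup M] {k : ℕ} {f g : Chains ι k →ₗ[ℤ] M}
    (h : ∀ t, f (Finsupp.single t 1) = g (Finsupp.single t 1)) : f = g :=
  Finsupp.lhom_ext' fun t => LinearMap.ext_ring (h t)

theorem bdry_single (k : ℕ) (t : Fin (k + 1) → ι) :
    bdry k (Finsupp.single t 1) =
      ∑ i : Fin (k + 1), Finsupp.single (fun j : Fin k => t (i.succAbove j))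
        ((-1 : ℤ) ^ (i : ℕ)) := by
  simp [bdry]

theorem cone_single (a : ι) (k : ℕ) (t : Fin k → ι) (m : ℤ) :
    cone a k (Finsupp.single t m) = Finsupp.single (Fin.cons a t : Fin (k + 1) → ι) m := by
  simp [cone, Finsupp.mapDomain_single]

theorem push_single (f : ι → κ) (k : ℕ) (t : Fin k → ι) (m : ℤ) :
    push f k (Finsupp.single t m) = Finsupp.single (f ∘ t) m := by
  simp [push, Finsupp.mapDomain_single]

theorem bdry_cone_zero (a : ι) (c : Chains ι 0) : bdry 0 (cone a 0 c) = c := by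
  have h : (bdry 0).comp (cone a 0) = (LinearMap.id : Chains ι 0 →ₗ[ℤ] Chains ι 0) := by
    apply chains_hom_ext
    intro t
    rw [LinearMap.comp_apply, LinearMap.id_apply, cone_single, bdry_single]
    rw [Fin.sum_univ_succ, Fin.sum_univ_zero, add_zero, Fin.val_zero, pow_zero]
    congr 1
  exact LinearMap.congr_fun h c

theorem bdry_cone_succ (a : ι) (k : ℕ) (c : Chains ι (k + 1)) :
    bdry (k + 1) (cone a (k + 1) c) = c - cone a k (bdry k c) := by
  have h : (bdry (k + 1)).comp (cone a (k + 1)) =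
      LinearMap.id - (cone a k).comp (bdry k) := by
    apply chains_hom_ext
    intro t
    rw [LinearMap.comp_apply, LinearMap.sub_apply, LinearMap.id_apply, LinearMap.comp_apply,
      cone_single, bdry_single, bdry_single,
      map_sum, Fin.sum_univ_succ, sub_eq_add_neg, ← Finset.sum_neg_distrib]
    congr 1
    refine Finset.sum_congr rfl fun i _ => ?_
    rw [cone_single, ← Finsupp.single_neg]
    congr 1
    · funext j
      refine Fin.cases ?_ (fun j => ?_) j <;> simp
    · simp [pow_succ]
  exact LinearMap.congr_fun h c

theorem bdry_bdry (k : ℕ) (c : Chains ι (k + 2)) : bdry k (bdry (k + 1) c) = 0 := by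
  induction k with
  | zero =>
    have h : (bdry 0).comp (bdry 1) = (0 : Chains ι 2 →ₗ[ℤ] Chains ι 0) := by
      apply chains_hom_ext
      intro t
      obtain ⟨a, s, rfl⟩ : ∃ a s, t = (Fin.cons a s : Fin 2 → ι) :=
        ⟨t 0, Fin.tail t, (Fin.cons_self_tail t).symm⟩
      rw [LinearMap.comp_apply, LinearMap.zero_apply, ← cone_single, bdry_cone_succ, map_sub,
        bdry_cone_zero, sub_self]
    exact LinearMap.congr_fun h c
  | succ k ih =>
    have h : (bdry (k + 1)).comp (bdry (k + 2)) =
        (0 : Chains ι (k + 3) →ₗ[ℤ] Chains ι (k + 1)) := by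
      apply chains_hom_ext
      intro t
      obtain ⟨a, s, rfl⟩ : ∃ a s, t = (Fin.cons a s : Fin (k + 3) → ι) :=
        ⟨t 0, Fin.tail t, (Fin.cons_self_tail t).symm⟩
      rw [LinearMap.comp_apply, LinearMap.zero_apply, ← cone_single, bdry_cone_succ, map_sub,
        bdry_cone_succ, ih, map_zero, sub_zero, sub_self]
    exact LinearMap.congr_fun h c

theorem bdry_push (f : ι → κ) (k : ℕ) (c : Chains ι (k + 1)) :
    bdry k (push f (k + 1) c) = push f k (bdry k c) := by
  have h : (bdry k).comp (push f (k + 1)) = (push f k).comp (bdry k) := by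
    apply chains_hom_ext
    intro t
    rw [LinearMap.comp_apply, LinearMap.comp_apply, push_single, bdry_single, bdry_single, map_sum]
    exact Finset.sum_congr rfl fun i _ => (push_single _ _ _ _).symm
  exact LinearMap.congr_fun h c

end

/-- A tuple spans a simplex if its entries are vertices of a common simplex; the empty tuple is
always allowed. -/
def Spans {ι : Type*} (X : AbstractSimplicialComplex ι) {k : ℕ} (t : Fin k → ι) : Prop :=
  k = 0 ∨ ∃ s ∈ X.faces, ∀ i, t i ∈ s

/-- The augmented ordered chains of the complex `X` in degree `k - 1`. -/
def chains {ι : Type*} (X : AbstractSimplicialComplex ι) (k : ℕ) : Submodule ℤ (Chains ι k) :=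
  Finsupp.supported ℤ ℤ {t | Spans X t}

/-- The reduced cycles of `X` in degree `k - 1`. -/
def cycles {ι : Type*} (X : AbstractSimplicialComplex ι) :
    (k : ℕ) → Submodule ℤ (Chains ι k)
  | 0 => chains X 0
  | k + 1 => chains X (k + 1) ⊓ LinearMap.ker (bdry k)

/-- The boundaries of `X` in degree `k - 1`. -/
def boundaries {ι : Type*} (X : AbstractSimplicialComplex ι) (k : ℕ) :
    Submodule ℤ (Chains ι k) :=
  (chains X (k + 1)).map (bdry k)

/-- The reduced simplicial homology group `H̃_{k-1}(X; ℤ)`, cycles modulo boundaries (note the shift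
of the index). -/
abbrev RedHomology {ι : Type*} (X : AbstractSimplicialComplex ι) (k : ℕ) : Type _ :=
  cycles X k ⧸ (boundaries X k).submoduleOf (cycles X k)

/-- The relative cycles of the pair `(X, A)` in degree `n`: chains of `X` whose boundary lies in
the subcomplex `A`. -/
def relCycles {ι : Type*} (X A : AbstractSimplicialComplex ι) (n : ℕ) :
    Submodule ℤ (Chains ι (n + 1)) :=
  chains X (n + 1) ⊓ (chains A n).comap (bdry n)

/-- The relative boundaries of the pair `(X, A)` in degree `n`. -/
def relBoundaries {ι : Type*} (X A : AbstractSimplicialComplex ι) (n : ℕ) :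
    Submodule ℤ (Chains ι (n + 1)) :=
  (chains X (n + 2)).map (bdry (n + 1)) ⊔ chains A (n + 1)

/-- The relative simplicial homology group `H_n(X, A; ℤ)` of a complex `X` and a subcomplex `A`
(no shift of the index). -/
abbrev RelHomology {ι : Type*} (X A : AbstractSimplicialComplex ι) (n : ℕ) : Type _ :=
  relCycles X A n ⧸ (relBoundaries X A n).submoduleOf (relCycles X A n)

section
variable {ι κ : Type*}

theorem single_mem_chains (X : AbstractSimplicialComplex ι) {k : ℕ} {t : Fin k → ι}
    (h : Spans X t) (m : ℤ) : Finsupp.single t m ∈ chains X k :=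
  Finsupp.single_mem_supported ℤ m h

theorem chains_le_iff (X : AbstractSimplicialComplex ι) {k : ℕ} {p : Submodule ℤ (Chains ι k)} :
    chains X k ≤ p ↔ ∀ t : Fin k → ι, Spans X t → Finsupp.single t (1 : ℤ) ∈ p := by
  rw [chains, Finsupp.supported_eq_span_single, Submodule.span_le]
  simp [Set.subset_def]

theorem chains_mono {X Y : AbstractSimplicialComplex ι} (h : X ≤ Y) (k : ℕ) :
    chains X k ≤ chains Y k :=
  Finsupp.supported_mono fun _ ht => ht.imp id fun ⟨s, hs, hst⟩ => ⟨s, h hs, hst⟩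

theorem bdry_mem_chains (X : AbstractSimplicialComplex ι) {k : ℕ} {c : Chains ι (k + 1)}
    (hc : c ∈ chains X (k + 1)) : bdry k c ∈ chains X k := by
  have : chains X (k + 1) ≤ (chains X k).comap (bdry k) := by
    rw [chains_le_iff]
    intro t ht
    rw [Submodule.mem_comap, bdry_single]
    refine Submodule.sum_mem _ fun i _ => single_mem_chains X ?_ _
    obtain h | ⟨s, hs, hst⟩ := ht
    · omega
    · exact Or.inr ⟨s, hs, fun j => hst _⟩
  exact this hc

theorem cycles_le_chains (X : AbstractSimplicialComplex ι) (k : ℕ) : cycles X k ≤ chains X k := by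
  cases k with
  | zero => exact le_rfl
  | succ k => exact inf_le_left

theorem bdry_mem_cycles (A : AbstractSimplicialComplex ι) {n : ℕ} {c : Chains ι (n + 1)}
    (hc : bdry n c ∈ chains A n) : bdry n c ∈ cycles A n := by
  cases n with
  | zero => exact hc
  | succ n => exact ⟨hc, bdry_bdry n c⟩

end

/-- The connecting morphism `H_n(X, A) → H̃_{n-1}(A)` of the long exact sequence of the pair: it
sends the class of a relative cycle to the class of its boundary. -/
def connecting {ι : Type*} (X A : AbstractSimplicialComplex ι) (n : ℕ) :
    RelHomology X A n →ₗ[ℤ] RedHomology A n :=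
  Submodule.mapQ _ _
    ((bdry n).restrict (p := relCycles X A n) (q := cycles A n)
      fun _ hc => bdry_mem_cycles A hc.2)
    (by
      rintro ⟨c, hc⟩ hc'
      obtain ⟨x, hx, a, ha, hxa⟩ := Submodule.mem_sup.1 (show c ∈ relBoundaries X A n from hc')
      obtain ⟨y, hy, rfl⟩ := hx
      refine ⟨a, ha, ?_⟩
      change bdry n a = bdry n c
      rw [← hxa, map_add, bdry_bdry, zero_add])

/-- A simplicial map: a map of vertices that sends simplices to simplices. -/
structure SimplicialMap {ι κ : Type*} (X : AbstractSimplicialComplex ι)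
    (Y : AbstractSimplicialComplex κ) where
  /-- the map of vertices -/
  toFun : ι → κ
  /-- the image of a simplex is a simplex -/
  image_mem : ∀ s ∈ X.faces, ∃ t ∈ Y.faces, (t : Set κ) = toFun '' s

section
variable {ι κ : Type*}

theorem push_mem_chains {X : AbstractSimplicialComplex ι} {Y : AbstractSimplicialComplex κ}
    (f : SimplicialMap X Y) {k : ℕ} {c : Chains ι k} (hc : c ∈ chains X k) :
    push f.toFun k c ∈ chains Y k := by
  have : chains X k ≤ (chains Y k).comap (push f.toFun k) := by
    rw [chains_le_iff]
    intro t ht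
    rw [Submodule.mem_comap, push_single]
    refine single_mem_chains Y ?_ _
    refine ht.imp id fun ⟨s, hs, hst⟩ => ?_
    obtain ⟨u, hu, hus⟩ := f.image_mem s hs
    refine ⟨u, hu, fun i => ?_⟩
    rw [← Finset.mem_coe, hus]
    exact ⟨t i, hst i, rfl⟩
  exact this hc

theorem push_mem_cycles {X : AbstractSimplicialComplex ι} {Y : AbstractSimplicialComplex κ}
    (f : SimplicialMap X Y) {k : ℕ} {c : Chains ι k} (hc : c ∈ cycles X k) :
    push f.toFun k c ∈ cycles Y k := by
  cases k with
  | zero => exact push_mem_chains f hc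
  | succ k =>
    refine ⟨push_mem_chains f hc.1, ?_⟩
    change bdry k _ = 0
    rw [bdry_push, LinearMap.mem_ker.1 hc.2, map_zero]

end

/-- The map induced by a simplicial map on reduced homology in degree `k - 1`. -/
def redMap {ι κ : Type*} {X : AbstractSimplicialComplex ι} {Y : AbstractSimplicialComplex κ}
    (f : SimplicialMap X Y) (k : ℕ) : RedHomology X k →ₗ[ℤ] RedHomology Y k :=
  Submodule.mapQ _ _
    ((push f.toFun k).restrict (p := cycles X k) (q := cycles Y k)
      fun _ hc => push_mem_cycles f hc)
    (by
      rintro ⟨c, hc⟩ ⟨x, hx, hxc⟩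
      refine ⟨push f.toFun (k + 1) x, push_mem_chains f hx, ?_⟩
      rw [bdry_push, hxc]
      rfl)

/-- The map induced on relative homology in degree `n` by a map of pairs, i.e. a simplicial map
`f : X → Y` that restricts to a simplicial map `g : A → B` of the subcomplexes. -/
def relMap {ι κ : Type*} {X A : AbstractSimplicialComplex ι} {Y B : AbstractSimplicialComplex κ}
    (f : SimplicialMap X Y) (g : SimplicialMap A B) (hfg : g.toFun = f.toFun) (n : ℕ) :
    RelHomology X A n →ₗ[ℤ] RelHomology Y B n :=
  Submodule.mapQ _ _
    ((push f.toFun (n + 1)).restrict (p := relCycles X A n) (q := relCycles Y B n)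
      fun c hc => ⟨push_mem_chains f hc.1, by
        have := push_mem_chains g hc.2
        rwa [hfg, ← bdry_push] at this⟩)
    (by
      rintro ⟨c, hc⟩ hc'
      obtain ⟨x, hx, a, ha, hxa⟩ := Submodule.mem_sup.1 (show c ∈ relBoundaries X A n from hc')
      obtain ⟨y, hy, rfl⟩ := hx
      change push f.toFun (n + 1) c ∈ relBoundaries Y B n
      rw [← hxa, map_add, ← bdry_push]
      refine Submodule.add_mem_sup ⟨_, push_mem_chains f hy, rfl⟩ ?_
      have := push_mem_chains g ha
      rwa [hfg] at this)

/-! ### Order complexes, posets of simplices and barycentric subdivision -/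

/-- The order complex of a poset: its simplices are the nonempty finite chains. -/
def orderComplex (P : Type*) [PartialOrder P] : AbstractSimplicialComplex P where
  faces := {s | s.Nonempty ∧ IsChain (· ≤ ·) (s : Set P)}
  isRelLowerSet_faces := fun _ hs =>
    ⟨hs.1, fun _ hts ht => ⟨ht, hs.2.mono (Finset.coe_subset.2 hts)⟩⟩
  singleton_mem := fun v => ⟨Finset.singleton_nonempty v, by simp⟩

/-- The simplicial map of order complexes induced by a poset map. -/
def orderComplexMap {P Q : Type*} [PartialOrder P] [PartialOrder Q] (f : P →o Q) :
    SimplicialMap (orderComplex P) (orderComplex Q) where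
  toFun := f
  image_mem := fun s hs => by
    classical
    refine ⟨s.image f, ⟨hs.1.image f, ?_⟩, Finset.coe_image⟩
    rw [Finset.coe_image]
    rintro _ ⟨a, ha, rfl⟩ _ ⟨b, hb, rfl⟩ _
    exact (hs.2.total ha hb).imp (fun h => f.monotone h) fun h => f.monotone h

/-- The poset of simplices `P(X)`, ordered by inclusion. -/
abbrev FacePoset {ι : Type*} (X : AbstractSimplicialComplex ι) : Type _ :=
  {s : Finset ι // s ∈ X.faces}

open Classical in
/-- The simplex spanned by a nonempty tuple whose entries are vertices of a common simplex. -/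
def spanSimplex {ι : Type*} (X : AbstractSimplicialComplex ι) {k : ℕ} (t : Fin (k + 1) → ι)
    (ht : Spans X t) : FacePoset X :=
  ⟨Finset.univ.image t, by
    obtain h | ⟨s, hs, hst⟩ := ht
    · omega
    · refine (X.isRelLowerSet_faces hs).2 ?_ ⟨t 0, Finset.mem_image_of_mem t (Finset.mem_univ 0)⟩
      intro x hx
      obtain ⟨i, _, rfl⟩ := Finset.mem_image.1 hx
      exact hst i⟩

open Classical in
/-- Barycentric subdivision on chains, `b : C_*(X) → C_*(P(X))`, by the usual recursion: a simplex
is sent to the cone, from its barycenter, over the subdivision of its boundary. (Tuples that do not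
span a simplex of `X` are sent to `0`.) -/
def subdivide {ι : Type*} (X : AbstractSimplicialComplex ι) :
    (k : ℕ) → Chains ι k →ₗ[ℤ] Chains (FacePoset X) k
  | 0 => Finsupp.lmapDomain ℤ ℤ fun _ => Fin.elim0
  | k + 1 => Finsupp.linearCombination ℤ fun t : Fin (k + 1) → ι =>
      if ht : Spans X t then
        cone (spanSimplex X t ht) k (subdivide X k (bdry k (Finsupp.single t 1)))
      else 0

section
variable {ι κ : Type*}

theorem subdivide_single (X : AbstractSimplicialComplex ι) {k : ℕ} {t : Fin (k + 1) → ι}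
    (ht : Spans X t) : subdivide X (k + 1) (Finsupp.single t 1) =
      cone (spanSimplex X t ht) k (subdivide X k (bdry k (Finsupp.single t 1))) := by
  rw [subdivide, Finsupp.linearCombination_single, one_smul, dif_pos ht]

theorem spans_omit (X : AbstractSimplicialComplex ι) {k : ℕ} {t : Fin (k + 1) → ι}
    (ht : Spans X t) (i : Fin (k + 1)) : Spans X fun j : Fin k => t (i.succAbove j) := by
  obtain h | ⟨s, hs, hst⟩ := ht
  · omega
  · exact Or.inr ⟨s, hs, fun j => hst _⟩

theorem bdry_subdivide (X : AbstractSimplicialComplex ι) (k : ℕ) {c : Chains ι (k + 1)}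
    (hc : c ∈ chains X (k + 1)) :
    bdry k (subdivide X (k + 1) c) = subdivide X k (bdry k c) := by
  induction k with
  | zero =>
    have : chains X 1 ≤ LinearMap.eqLocus ((bdry 0).comp (subdivide X 1))
        ((subdivide X 0).comp (bdry 0)) := by
      rw [chains_le_iff]
      intro t ht
      rw [LinearMap.mem_eqLocus, LinearMap.comp_apply, LinearMap.comp_apply,
        subdivide_single X ht, bdry_cone_zero]
    exact this hc
  | succ k ih =>
    have : chains X (k + 2) ≤ LinearMap.eqLocus ((bdry (k + 1)).comp (subdivide X (k + 2)))
        ((subdivide X (k + 1)).comp (bdry (k + 1))) := by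
      rw [chains_le_iff]
      intro t ht
      rw [LinearMap.mem_eqLocus, LinearMap.comp_apply, LinearMap.comp_apply,
        subdivide_single X ht, bdry_cone_succ,
        ih (bdry_mem_chains X (single_mem_chains X ht 1)), bdry_bdry, map_zero, map_zero,
        sub_zero]
    exact this hc

/-- The subdivision of a tuple consists of flags of faces of the simplex that it spans. -/
theorem subdivide_mem_supported (X : AbstractSimplicialComplex ι) : ∀ (k : ℕ) (t : Fin k → ι),
    Spans X t → subdivide X k (Finsupp.single t 1) ∈ Finsupp.supported ℤ ℤ
      {u : Fin k → FacePoset X | IsChain (· ≤ ·) (Set.range u) ∧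
        ∀ i, ((u i : Finset ι) : Set ι) ⊆ Set.range t} := by
  classical
  intro k
  induction k with
  | zero =>
    intro t _
    rw [subdivide, Finsupp.lmapDomain_apply, Finsupp.mapDomain_single]
    refine Finsupp.single_mem_supported ℤ _ ⟨?_, fun i => i.elim0⟩
    rw [Set.range_eq_empty]
    exact IsChain.empty
  | succ k ih =>
    intro t ht
    rw [subdivide_single X ht, bdry_single, map_sum, map_sum]
    refine Submodule.sum_mem _ fun i _ => ?_
    have h := ih _ (spans_omit X ht i)
    have h1 : Finsupp.single (fun j : Fin k => t (i.succAbove j)) ((-1 : ℤ) ^ (i : ℕ)) =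
        ((-1 : ℤ) ^ (i : ℕ)) • Finsupp.single (fun j : Fin k => t (i.succAbove j)) (1 : ℤ) := by
      simp
    rw [h1, map_smul, map_smul]
    refine Submodule.smul_mem _ _ ?_
    rw [Finsupp.supported_eq_span_single] at h
    refine Submodule.span_induction ?_ ?_ ?_ ?_ h
    · rintro _ ⟨u, ⟨hu, hut⟩, rfl⟩
      rw [cone_single]
      have key : ∀ j, ((u j : Finset ι) : Set ι) ⊆ Set.range t := fun j =>
        (hut j).trans (by rintro _ ⟨l, rfl⟩; exact ⟨_, rfl⟩)
      refine Finsupp.single_mem_supported ℤ _ ⟨?_, fun j => ?_⟩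
      · rw [Fin.range_cons]
        refine hu.insert ?_
        rintro _ ⟨j, rfl⟩ _
        refine Or.inr fun x hx => ?_
        obtain ⟨l, rfl⟩ := key j hx
        simp [spanSimplex]
      · refine Fin.cases ?_ (fun j => ?_) j
        · rw [Fin.cons_zero]
          intro x hx
          simpa [spanSimplex] using hx
        · rw [Fin.cons_succ]
          exact key j
    · rw [map_zero]; exact Submodule.zero_mem _
    · intro x y _ _ hx hy; rw [map_add]; exact Submodule.add_mem _ hx hy
    · intro a x _ hx; rw [map_smul]; exact Submodule.smul_mem _ _ hx

theorem subdivide_mem_chains (X : AbstractSimplicialComplex ι) {k : ℕ} {c : Chains ι k}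
    (hc : c ∈ chains X k) : subdivide X k c ∈ chains (orderComplex (FacePoset X)) k := by
  classical
  have : chains X k ≤ (chains (orderComplex (FacePoset X)) k).comap (subdivide X k) := by
    rw [chains_le_iff]
    intro t ht
    refine Finsupp.supported_mono ?_ (subdivide_mem_supported X k t ht)
    rintro u ⟨hu, _⟩
    cases k with
    | zero => exact Or.inl rfl
    | succ k =>
      refine Or.inr ⟨Finset.univ.image u, ⟨⟨u 0, Finset.mem_image_of_mem u (Finset.mem_univ 0)⟩,
        ?_⟩, fun i => Finset.mem_image_of_mem u (Finset.mem_univ i)⟩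
      rw [Finset.coe_image, Finset.coe_univ, Set.image_univ]
      exact hu
  exact this hc

end

/-- The map `b : H̃_{k-1}(X) → H̃_{k-1}(P(X))` induced by barycentric subdivision. -/
def subdivision {ι : Type*} (X : AbstractSimplicialComplex ι) (k : ℕ) :
    RedHomology X k →ₗ[ℤ] RedHomology (orderComplex (FacePoset X)) k :=
  Submodule.mapQ _ _
    ((subdivide X k).restrict (p := cycles X k) (q := cycles (orderComplex (FacePoset X)) k)
      fun c hc => by
        cases k with
        | zero => exact subdivide_mem_chains X hc
        | succ k =>
          refine ⟨subdivide_mem_chains X hc.1, ?_⟩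
          change bdry k _ = 0
          rw [bdry_subdivide X k hc.1, LinearMap.mem_ker.1 hc.2, map_zero])
    (by
      rintro ⟨c, hc⟩ ⟨x, hx, hxc⟩
      refine ⟨subdivide X (k + 1) x, subdivide_mem_chains X hx, ?_⟩
      rw [bdry_subdivide X k hx, hxc]
      rfl)

/-! ### Symplectic linear algebra -/

/-- The index set `{1, 1̄, …, n, n̄}` of the standard symplectic basis: `Sum.inl i` is the index of
`e_i` (written `i`) and `Sum.inr i` is the index of `f_i` (written `ī`). -/
abbrev SymIdx (n : ℕ) : Type := Fin n ⊕ Fin n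

/-- The standard symplectic form on `R^{2n}`, with `ω(e_i, f_i) = 1 = -ω(f_i, e_i)`. -/
def omega {n : ℕ} {R : Type*} [CommRing R] (x y : SymIdx n → R) : R :=
  ∑ i : Fin n, (x (Sum.inl i) * y (Sum.inr i) - x (Sum.inr i) * y (Sum.inl i))

/-- A submodule of `R^{2n}` is isotropic if the symplectic form vanishes on it. -/
def IsIsotropic {n : ℕ} {R : Type*} [CommRing R] (p : Submodule R (SymIdx n → R)) : Prop :=
  ∀ x ∈ p, ∀ y ∈ p, omega x y = 0

/-- The set of rank-1 summands of `ℤ^{2n}`. -/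
abbrev Line (n : ℕ) : Type :=
  {v : Submodule ℤ (SymIdx n → ℤ) // IsComplemented v ∧ Module.finrank ℤ v = 1}

instance (n : ℕ) : DecidableEq (Line n) := Classical.decEq _

/-- The submodule `⟨Δ⟩` of `ℤ^{2n}` spanned by a finite set of lines. -/
def lineSpan {n : ℕ} (s : Finset (Line n)) : Submodule ℤ (SymIdx n → ℤ) := ⨆ v ∈ s, v.1

/-- `x` is one of the two primitive vectors that generate the line `v`. -/
def Generates {n : ℕ} (x : SymIdx n → ℤ) (v : Line n) : Prop := v.1 = Submodule.span ℤ {x}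

/-- Standard simplices: the lines span an isotropic summand of rank the number of lines. -/
def IsStandard {n : ℕ} (s : Finset (Line n)) : Prop :=
  s.Nonempty ∧ IsIsotropic (lineSpan s) ∧ IsComplemented (lineSpan s) ∧
    Module.finrank ℤ (lineSpan s) = s.card

/-- `s` is a 2-additive simplex with `v₀ = ± v₁ ± v₂`. (The signs are absorbed in the choice of the
generators `x₁` and `x₂`.) -/
def IsTwoAdditiveWith {n : ℕ} (s : Finset (Line n)) (v₀ v₁ v₂ : Line n) : Prop :=
  v₀ ∈ s ∧ v₁ ∈ s.erase v₀ ∧ v₂ ∈ (s.erase v₀).erase v₁ ∧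
    (∃ x₁ x₂, Generates x₁ v₁ ∧ Generates x₂ v₂ ∧ Generates (x₁ + x₂) v₀) ∧
    IsStandard (s.erase v₀)

/-- 2-additive simplices. -/
def IsTwoAdditive {n : ℕ} (s : Finset (Line n)) : Prop :=
  ∃ v₀ v₁ v₂, IsTwoAdditiveWith s v₀ v₁ v₂

/-- `s` is a `σ` simplex with `σ` edge `{v, w}`: `ω(v, w) = ± 1`, the line `v` is orthogonal to all
lines other than `w`, and `s ∖ {v}` is a standard simplex. -/
def IsSigmaWith {n : ℕ} (s : Finset (Line n)) (v w : Line n) : Prop :=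
  v ∈ s ∧ w ∈ s.erase v ∧
    (∃ x y, Generates x v ∧ Generates y w ∧ (omega x y = 1 ∨ omega x y = -1)) ∧
    (∀ u ∈ (s.erase v).erase w, ∀ x ∈ v.1, ∀ y ∈ u.1, omega x y = 0) ∧
    IsStandard (s.erase v)

/-- `σ` simplices. -/
def IsSigma {n : ℕ} (s : Finset (Line n)) : Prop := ∃ v w, IsSigmaWith s v w

/-- Mixed simplices: `s ∖ {v₀}` is a `σ` simplex with `σ` edge `{v, w}`, `s ∖ {v}` is a 2-additive
simplex with `v₀ = ± v₁ ± v₂`, and the `σ` edge is disjoint from `{v₀, v₁, v₂}`. -/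
def IsMixed {n : ℕ} (s : Finset (Line n)) : Prop :=
  ∃ v₀ v₁ v₂ v w, v₀ ∈ s ∧ v ∈ s ∧ w ≠ v₁ ∧ w ≠ v₂ ∧
    IsSigmaWith (s.erase v₀) v w ∧ IsTwoAdditiveWith (s.erase v) v₀ v₁ v₂

section
variable {n : ℕ} {R : Type*} [CommRing R]

theorem omega_add_left (x y z : SymIdx n → R) : omega (x + y) z = omega x z + omega y z := by
  simp only [omega, ← Finset.sum_add_distrib, Pi.add_apply]
  exact Finset.sum_congr rfl fun _ _ => by ring

theorem omega_smul_left (a : R) (x y : SymIdx n → R) : omega (a • x) y = a * omega x y := by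
  simp only [omega, Finset.mul_sum, Pi.smul_apply, smul_eq_mul]
  exact Finset.sum_congr rfl fun _ _ => by ring

theorem omega_swap (x y : SymIdx n → R) : omega y x = -omega x y := by
  simp only [omega, ← Finset.sum_neg_distrib]
  exact Finset.sum_congr rfl fun _ _ => by ring

theorem omega_self (x : SymIdx n → R) : omega x x = 0 := by
  simp only [omega]
  exact Finset.sum_eq_zero fun _ _ => by ring

theorem omega_add_right (x y z : SymIdx n → R) : omega x (y + z) = omega x y + omega x z := by
  rw [omega_swap, omega_add_left, omega_swap x y, omega_swap x z]; ring

theorem omega_smul_right (a : R) (x y : SymIdx n → R) : omega x (a • y) = a * omega x y := by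
  rw [omega_swap, omega_smul_left, omega_swap x y]; ring

theorem omega_zero_left (y : SymIdx n → R) : omega 0 y = 0 := by simp [omega]

theorem omega_zero_right (x : SymIdx n → R) : omega x 0 = 0 := by simp [omega]

/-- The linear functional `ω(·, y)`. -/
def omegaLeft (y : SymIdx n → R) : (SymIdx n → R) →ₗ[R] R where
  toFun x := omega x y
  map_add' a b := omega_add_left a b y
  map_smul' a b := omega_smul_left a b y

theorem isIsotropic_span {S : Set (SymIdx n → R)} (h : ∀ x ∈ S, ∀ y ∈ S, omega x y = 0) :
    IsIsotropic (Submodule.span R S) := by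
  intro x hx y hy
  induction hx using Submodule.span_induction with
  | zero => exact omega_zero_left y
  | add a b _ _ ha hb => rw [omega_add_left, ha, hb, add_zero]
  | smul a b _ hb => rw [omega_smul_left, hb, mul_zero]
  | mem x hx =>
    induction hy using Submodule.span_induction with
    | zero => exact omega_zero_right x
    | add a b _ _ ha hb => rw [omega_add_right, ha, hb, add_zero]
    | smul a b _ hb => rw [omega_smul_right, hb, mul_zero]
    | mem y hy => exact h x hx y hy

theorem exists_generates (v : Line n) : ∃ x, Generates x v := by
  obtain ⟨x, hx⟩ := finrank_eq_one_iff'.1 v.2.2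
  refine ⟨x.1, le_antisymm (fun y hy => ?_) ?_⟩
  · obtain ⟨c, hc⟩ := hx.2 ⟨y, hy⟩
    rw [Submodule.mem_span_singleton]
    exact ⟨c, congrArg Subtype.val hc⟩
  · rw [Submodule.span_singleton_le_iff_mem]
    exact x.2

/-- A chosen generator of a line. -/
def gen (v : Line n) : SymIdx n → ℤ := (exists_generates v).choose

theorem generates_gen (v : Line n) : Generates (gen v) v := (exists_generates v).choose_spec

theorem lineSpan_eq_span {s : Finset (Line n)} {g : Line n → SymIdx n → ℤ}
    (hg : ∀ v ∈ s, Generates (g v) v) : lineSpan s = Submodule.span ℤ (g '' s) := by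
  rw [lineSpan, Set.image_eq_iUnion, Submodule.span_iUnion₂]
  exact iSup_congr fun v => iSup_congr fun hv => hg v hv

theorem lineSpan_mono {s t : Finset (Line n)} (h : s ⊆ t) : lineSpan s ≤ lineSpan t :=
  biSup_mono fun _ hv => h hv

theorem le_lineSpan {s : Finset (Line n)} {v : Line n} (h : v ∈ s) : v.1 ≤ lineSpan s :=
  le_biSup (fun v : Line n => v.1) h

theorem Generates.mem {x : SymIdx n → ℤ} {v : Line n} (h : Generates x v) : x ∈ v.1 := by
  rw [h]; exact Submodule.mem_span_singleton_self x

theorem lineSpan_le {s : Finset (Line n)} {p : Submodule ℤ (SymIdx n → ℤ)} :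
    lineSpan s ≤ p ↔ ∀ v ∈ s, v.1 ≤ p := iSup₂_le_iff

/-- Vectors with a system of dual functionals span a summand of the right rank. -/
theorem summand_of_dual {ι : Type*} {s : Finset ι} {g : ι → SymIdx n → ℤ}
    {φ : ι → (SymIdx n → ℤ) →ₗ[ℤ] ℤ} (h1 : ∀ v ∈ s, φ v (g v) = 1)
    (h0 : ∀ v ∈ s, ∀ w ∈ s, v ≠ w → φ v (g w) = 0) :
    IsComplemented (Submodule.span ℤ (g '' s)) ∧
      Module.finrank ℤ (Submodule.span ℤ (g '' s)) = s.card := by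
  classical
  have hdual : ∀ c : ι → ℤ, ∀ v ∈ s, φ v (∑ w ∈ s, c w • g w) = c v := by
    intro c v hv
    rw [map_sum, Finset.sum_eq_single v]
    · rw [map_smul, h1 v hv, smul_eq_mul, mul_one]
    · intro w hw hwv
      rw [map_smul, h0 v hv w hw hwv.symm, smul_zero]
    · exact fun h => (h hv).elim
  constructor
  · let f : (SymIdx n → ℤ) →ₗ[ℤ] Submodule.span ℤ (g '' s) :=
      LinearMap.codRestrict _ (∑ v ∈ s, (φ v).smulRight (g v)) fun x => by
        rw [LinearMap.sum_apply]
        exact Submodule.sum_mem _ fun v hv =>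
          Submodule.smul_mem _ _ (Submodule.subset_span ⟨v, hv, rfl⟩)
    have hf : ∀ x : Submodule.span ℤ (g '' s), f x = x := by
      rintro ⟨x, hx⟩
      apply Subtype.ext
      change (∑ v ∈ s, (φ v).smulRight (g v)) x = x
      rw [LinearMap.sum_apply]
      induction hx using Submodule.span_induction with
      | zero => simp
      | add a b _ _ ha hb =>
        simp only [map_add, Finset.sum_add_distrib]
        rw [ha, hb]
      | smul a b _ hb =>
        simp only [map_smul]
        rw [← Finset.smul_sum, hb]
      | mem x hx =>
        obtain ⟨w, hw, rfl⟩ := hx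
        rw [Finset.sum_eq_single w]
        · simp [h1 w hw]
        · intro v hv hvw
          simp [h0 v hv w hw hvw]
        · exact fun h => (h hw).elim
    exact ⟨_, LinearMap.isCompl_of_proj hf⟩
  · have hli : LinearIndependent ℤ fun v : s => g v := by
      rw [Fintype.linearIndependent_iff]
      intro c hc v
      have := hdual (fun w => if hw : w ∈ s then c ⟨w, hw⟩ else 0) v.1 v.2
      rw [← Finset.sum_coe_sort s] at this
      simp only [Finset.coe_mem, dite_true, Subtype.coe_eta] at this
      rw [← this, hc, map_zero]
    have := finrank_span_eq_card hli
    rw [Fintype.card_coe] at this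
    rw [← this, Set.image_eq_range]
    rfl

/-- The converse of `summand_of_dual`. -/
theorem exists_dual {s : Finset (Line n)} (h : IsComplemented (lineSpan s))
    (hr : Module.finrank ℤ (lineSpan s) = s.card) :
    ∃ φ : Line n → (SymIdx n → ℤ) →ₗ[ℤ] ℤ, (∀ v ∈ s, φ v (gen v) = 1) ∧
      ∀ v ∈ s, ∀ w ∈ s, v ≠ w → φ v (gen w) = 0 := by
  classical
  obtain ⟨q, hq⟩ := h
  let g : s → lineSpan s := fun v => ⟨gen v.1, le_lineSpan v.2 (generates_gen v.1).mem⟩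
  have htop : ⊤ ≤ Submodule.span ℤ (Set.range g) := by
    rintro ⟨x, hx⟩ -
    have hx' := hx
    rw [lineSpan_eq_span fun v _ => generates_gen v] at hx'
    have : (Submodule.span ℤ (Set.range g)).map (lineSpan s).subtype =
        Submodule.span ℤ (gen '' s) := by
      rw [Submodule.map_span, ← Set.range_comp]
      congr 1
      ext y
      simp [g]
    rw [← this] at hx'
    obtain ⟨y, hy, hyx⟩ := hx'
    have : y = ⟨x, hx⟩ := Subtype.ext hyx
    rwa [← this]
  have hli : LinearIndependent ℤ g :=
    linearIndependent_of_top_le_span_of_card_eq_finrank htop (by rw [hr, Fintype.card_coe])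
  let b := Module.Basis.mk hli htop
  let pr : (SymIdx n → ℤ) →ₗ[ℤ] lineSpan s := Submodule.projectionOnto _ _ hq
  refine ⟨fun v => if hv : v ∈ s then (b.coord ⟨v, hv⟩).comp pr else 0, ?_, ?_⟩
  · intro v hv
    have : pr (gen v) = b ⟨v, hv⟩ := by
      rw [Module.Basis.mk_apply]
      exact Submodule.projectionOnto_apply_left hq (g ⟨v, hv⟩)
    simp only [hv, dite_true, LinearMap.comp_apply, this]
    simp
  · intro v hv w hw hvw
    have : pr (gen w) = b ⟨w, hw⟩ := by
      rw [Module.Basis.mk_apply]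
      exact Submodule.projectionOnto_apply_left hq (g ⟨w, hw⟩)
    simp only [hv, dite_true, LinearMap.comp_apply, this]
    simp [hvw.symm]

/-- A criterion for standard simplices. -/
theorem isStandard_of_dual {s : Finset (Line n)} {g : Line n → SymIdx n → ℤ} (hs : s.Nonempty)
    (hg : ∀ v ∈ s, Generates (g v) v) (hω : ∀ v ∈ s, ∀ w ∈ s, omega (g v) (g w) = 0)
    {φ : Line n → (SymIdx n → ℤ) →ₗ[ℤ] ℤ} (h1 : ∀ v ∈ s, φ v (g v) = 1)
    (h0 : ∀ v ∈ s, ∀ w ∈ s, v ≠ w → φ v (g w) = 0) : IsStandard s := by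
  rw [IsStandard, lineSpan_eq_span hg]
  refine ⟨hs, isIsotropic_span ?_, summand_of_dual h1 h0⟩
  rintro _ ⟨v, hv, rfl⟩ _ ⟨w, hw, rfl⟩
  exact hω v hv w hw

theorem IsStandard.omega_eq_zero {s : Finset (Line n)} (hs : IsStandard s) {v w : Line n}
    (hv : v ∈ s) (hw : w ∈ s) {x y : SymIdx n → ℤ} (hx : x ∈ v.1) (hy : y ∈ w.1) :
    omega x y = 0 :=
  hs.2.1 x (le_lineSpan hv hx) y (le_lineSpan hw hy)

theorem IsStandard.subset {s t : Finset (Line n)} (hs : IsStandard s) (hts : t ⊆ s)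
    (ht : t.Nonempty) : IsStandard t := by
  obtain ⟨φ, h1, h0⟩ := exists_dual hs.2.2.1 hs.2.2.2
  exact isStandard_of_dual ht (fun v _ => generates_gen v)
    (fun v hv w hw => hs.omega_eq_zero (hts hv) (hts hw) (generates_gen v).mem
      (generates_gen w).mem)
    (fun v hv => h1 v (hts hv)) fun v hv w hw => h0 v (hts hv) w (hts hw)

theorem isStandard_singleton (v : Line n) : IsStandard {v} := by
  have h : lineSpan {v} = v.1 := by simp [lineSpan]
  rw [IsStandard, h]
  refine ⟨Finset.singleton_nonempty v, ?_, v.2.1, by simpa using v.2.2⟩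
  have := generates_gen v
  rw [this]
  refine isIsotropic_span ?_
  rintro _ rfl _ rfl
  exact omega_self _

/-- In a 2-additive simplex the roles of the three dependent lines can be exchanged. -/
theorem IsTwoAdditiveWith.isStandard_erase {s : Finset (Line n)} {v₀ v₁ v₂ : Line n}
    (h : IsTwoAdditiveWith s v₀ v₁ v₂) : IsStandard (s.erase v₁) ∧ IsStandard (s.erase v₂) ∧
      lineSpan s = lineSpan (s.erase v₀) := by
  obtain ⟨hv₀, hv₁, hv₂, ⟨x₁, x₂, hx₁, hx₂, hx₀⟩, hs⟩ := h
  rw [Finset.mem_erase] at hv₁ hv₂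
  have hv₂' := Finset.mem_erase.1 hv₂.2
  have key : ∀ a b c : Line n, ∀ x y z : SymIdx n → ℤ, Generates x a → Generates y b →
      Generates z c → b ∈ s → c ∈ s → b ≠ a → c ≠ a →
      x ∈ Submodule.span ℤ {y, z} → lineSpan s = lineSpan (s.erase a) := by
    intro a b c x y z hx hy hz hb hc hba hca hxyz
    refine le_antisymm (lineSpan_le.2 fun v hv => ?_) (lineSpan_mono (Finset.erase_subset a s))
    by_cases hva : v = a
    · subst hva
      rw [hx, Submodule.span_singleton_le_iff_mem]
      refine Submodule.span_le.2 ?_ hxyz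
      rintro u (rfl | rfl)
      · exact le_lineSpan (Finset.mem_erase.2 ⟨hba, hb⟩) hy.mem
      · exact le_lineSpan (Finset.mem_erase.2 ⟨hca, hc⟩) hz.mem
    · exact le_lineSpan (Finset.mem_erase.2 ⟨hva, hv⟩)
  have e₀ := key v₀ v₁ v₂ _ _ _ hx₀ hx₁ hx₂ hv₁.2 hv₂'.2 hv₁.1 hv₂'.1
    (Submodule.mem_span_pair.2 ⟨1, 1, by simp⟩)
  have e₁ := key v₁ v₀ v₂ _ _ _ hx₁ hx₀ hx₂ hv₀ hv₂'.2 hv₁.1.symm hv₂.1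
    (Submodule.mem_span_pair.2 ⟨1, -1, by simp⟩)
  have e₂ := key v₂ v₀ v₁ _ _ _ hx₂ hx₀ hx₁ hv₀ hv₁.2 hv₂'.1.symm hv₂.1.symm
    (Submodule.mem_span_pair.2 ⟨1, -1, by simp⟩)
  have main : ∀ a ∈ s, a ≠ v₀ → lineSpan s = lineSpan (s.erase a) → IsStandard (s.erase a) := by
    intro a ha hav e
    rw [IsStandard, ← e, e₀, Finset.card_erase_of_mem ha, ← Finset.card_erase_of_mem hv₀]
    exact ⟨⟨v₀, Finset.mem_erase.2 ⟨hav.symm, hv₀⟩⟩, hs.2⟩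
  exact ⟨main v₁ hv₁.2 hv₁.1 e₁, main v₂ hv₂'.2 hv₂'.1 e₂, e₀⟩

theorem IsTwoAdditiveWith.subset {s t : Finset (Line n)} {v₀ v₁ v₂ : Line n}
    (h : IsTwoAdditiveWith s v₀ v₁ v₂) (hts : t ⊆ s) (h₀ : v₀ ∈ t) (h₁ : v₁ ∈ t) (h₂ : v₂ ∈ t) :
    IsTwoAdditiveWith t v₀ v₁ v₂ := by
  obtain ⟨hv₀, hv₁, hv₂, hx, hs⟩ := h
  have h1 : v₁ ∈ t.erase v₀ := Finset.mem_erase.2 ⟨(Finset.mem_erase.1 hv₁).1, h₁⟩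
  refine ⟨h₀, h1, ?_, hx, hs.subset (Finset.erase_subset_erase _ hts) ⟨_, h1⟩⟩
  simp only [Finset.mem_erase] at hv₂ ⊢
  exact ⟨hv₂.1, hv₂.2.1, h₂⟩

theorem IsTwoAdditive.subset {s t : Finset (Line n)} (h : IsTwoAdditive s) (hts : t ⊆ s)
    (ht : t.Nonempty) : IsStandard t ∨ IsTwoAdditive t := by
  obtain ⟨v₀, v₁, v₂, h⟩ := h
  by_cases h₀ : v₀ ∈ t
  · by_cases h₁ : v₁ ∈ t
    · by_cases h₂ : v₂ ∈ t
      · exact Or.inr ⟨v₀, v₁, v₂, h.subset hts h₀ h₁ h₂⟩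
      · exact Or.inl (h.isStandard_erase.2.1.subset (Finset.subset_erase.2 ⟨hts, h₂⟩) ht)
    · exact Or.inl (h.isStandard_erase.1.subset (Finset.subset_erase.2 ⟨hts, h₁⟩) ht)
  · exact Or.inl (h.2.2.2.2.subset (Finset.subset_erase.2 ⟨hts, h₀⟩) ht)

theorem IsSigmaWith.subset {s t : Finset (Line n)} {v w : Line n} (h : IsSigmaWith s v w)
    (hts : t ⊆ s) (hv : v ∈ t) (hw : w ∈ t) : IsSigmaWith t v w := by
  obtain ⟨hv', hw', hx, hu, hs⟩ := h
  have h1 : w ∈ t.erase v := Finset.mem_erase.2 ⟨(Finset.mem_erase.1 hw').1, hw⟩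
  exact ⟨hv, h1, hx, fun u hu' => hu u
    (Finset.erase_subset_erase _ (Finset.erase_subset_erase _ hts) hu'),
    hs.subset (Finset.erase_subset_erase _ hts) ⟨_, h1⟩⟩

theorem IsSigmaWith.isStandard_erase {s : Finset (Line n)} {v w : Line n}
    (h : IsSigmaWith s v w) : IsStandard (s.erase w) := by
  obtain ⟨hv, hw, ⟨x, y, hx, hy, hxy⟩, hu, hs⟩ := h
  obtain ⟨φ, h1, h0⟩ := exists_dual hs.2.2.1 hs.2.2.2
  have hwv := (Finset.mem_erase.1 hw).1
  -- the functional `ε ω(·, y)` is `1` on `x` and vanishes on the other lines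
  obtain ⟨ψ, hψx, hψ⟩ : ∃ ψ : (SymIdx n → ℤ) →ₗ[ℤ] ℤ, ψ x = 1 ∧
      ∀ u ∈ (s.erase v).erase w, ψ (gen u) = 0 := by
    refine ⟨omega x y • omegaLeft y, ?_, fun u hu' => ?_⟩
    · change omega x y * omega x y = 1
      obtain h | h := hxy <;> rw [h] <;> rfl
    · have : omega (gen u) y = 0 :=
        hs.omega_eq_zero (Finset.mem_of_mem_erase hu') hw (generates_gen u).mem hy.mem
      change omega x y * omega (gen u) y = 0
      rw [this, mul_zero]
  have hmem : ∀ u ∈ s.erase w, u ≠ v → u ∈ (s.erase v).erase w := by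
    intro u hu' huv
    rw [Finset.mem_erase] at hu'
    exact Finset.mem_erase.2 ⟨hu'.1, Finset.mem_erase.2 ⟨huv, hu'.2⟩⟩
  refine isStandard_of_dual (g := fun u => if u = v then x else gen u)
    (φ := fun u => if u = v then ψ else φ u - φ u x • ψ)
    ⟨v, Finset.mem_erase.2 ⟨hwv.symm, hv⟩⟩ ?_ ?_ ?_ ?_
  · intro u _
    by_cases huv : u = v
    · simp only [huv, if_true]; exact hx
    · simp only [huv, if_false]; exact generates_gen u
  · intro a ha b hb
    by_cases hav : a = v <;> by_cases hbv : b = v <;> simp only [hav, hbv, if_true, if_false]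
    · exact omega_self x
    · exact hu b (hmem b hb hbv) x hx.mem _ (generates_gen b).mem
    · rw [omega_swap, hu a (hmem a ha hav) x hx.mem _ (generates_gen a).mem, neg_zero]
    · exact hs.omega_eq_zero (Finset.mem_of_mem_erase (hmem a ha hav))
        (Finset.mem_of_mem_erase (hmem b hb hbv)) (generates_gen a).mem (generates_gen b).mem
  · intro a ha
    by_cases hav : a = v
    · simp only [hav, if_true]; exact hψx
    · simp only [hav, if_false, LinearMap.sub_apply, LinearMap.smul_apply]
      rw [hψ a (hmem a ha hav), h1 a (Finset.mem_of_mem_erase (hmem a ha hav)), smul_zero, sub_zero]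
  · intro a ha b hb hab
    by_cases hav : a = v
    · have hbv : b ≠ v := fun h => hab (hav.trans h.symm)
      simp only [hav, hbv, if_true, if_false]
      exact hψ b (hmem b hb hbv)
    · by_cases hbv : b = v
      · simp only [hav, hbv, if_true, if_false, LinearMap.sub_apply, LinearMap.smul_apply]
        rw [hψx, smul_eq_mul, mul_one, sub_self]
      · simp only [hav, hbv, if_false, LinearMap.sub_apply, LinearMap.smul_apply]
        rw [hψ b (hmem b hb hbv), h0 a (Finset.mem_of_mem_erase (hmem a ha hav)) b
          (Finset.mem_of_mem_erase (hmem b hb hbv)) hab, smul_zero, sub_zero]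

theorem IsSigma.subset {s t : Finset (Line n)} (h : IsSigma s) (hts : t ⊆ s)
    (ht : t.Nonempty) : IsStandard t ∨ IsSigma t := by
  obtain ⟨v, w, h⟩ := h
  by_cases hv : v ∈ t
  · by_cases hw : w ∈ t
    · exact Or.inr ⟨v, w, h.subset hts hv hw⟩
    · exact Or.inl (h.isStandard_erase.subset (Finset.subset_erase.2 ⟨hts, hw⟩) ht)
  · exact Or.inl (h.2.2.2.2.subset (Finset.subset_erase.2 ⟨hts, hv⟩) ht)

/-- In a mixed simplex the roles of the three dependent lines can be exchanged. -/
theorem isSigmaWith_erase_of_mixed {s : Finset (Line n)} {v₀ v₁ v₂ v w a b : Line n}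
    (hv₀ : v₀ ∈ s) (hs : IsSigmaWith (s.erase v₀) v w)
    (ht : IsTwoAdditiveWith (s.erase v) v₀ v₁ v₂) (ha : (a = v₁ ∧ b = v₂) ∨ (a = v₂ ∧ b = v₁))
    (hwa : w ≠ a) (hwb : w ≠ b) : IsSigmaWith (s.erase a) v w := by
  obtain ⟨hv, hw, hx, hu, -⟩ := hs
  obtain ⟨x₁, x₂, hx₁, hx₂, hx₀⟩ := ht.2.2.2.1
  have hst : IsStandard ((s.erase v).erase a) := by
    obtain ⟨rfl, -⟩ | ⟨rfl, -⟩ := ha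
    · exact ht.isStandard_erase.1
    · exact ht.isStandard_erase.2.1
  have h1 := ht.2.1
  have h2 := ht.2.2.1
  simp only [Finset.mem_erase] at hv hw h1 h2
  have hu₁ : ∀ x ∈ v.1, omega x x₁ = 0 := fun x hx => hu v₁ (by
    simp only [Finset.mem_erase]
    refine ⟨?_, h1.2.1, h1.1, h1.2.2⟩
    obtain ⟨rfl, -⟩ | ⟨-, rfl⟩ := ha
    · exact hwa.symm
    · exact hwb.symm) x hx x₁ hx₁.mem
  have hu₂ : ∀ x ∈ v.1, omega x x₂ = 0 := fun x hx => hu v₂ (by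
    simp only [Finset.mem_erase]
    refine ⟨?_, h2.2.2.1, h2.2.1, h2.2.2.2⟩
    obtain ⟨-, rfl⟩ | ⟨rfl, -⟩ := ha
    · exact hwb.symm
    · exact hwa.symm) x hx x₂ hx₂.mem
  have hav : a ≠ v := by
    obtain ⟨rfl, -⟩ | ⟨rfl, -⟩ := ha
    · exact h1.2.1
    · exact h2.2.2.1
  refine ⟨?_, ?_, hx, ?_, ?_⟩
  · exact Finset.mem_erase.2 ⟨hav.symm, hv.2⟩
  · simp only [Finset.mem_erase]; exact ⟨hw.1, hwa, hw.2.2⟩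
  · intro u hu' x hx y hy
    simp only [Finset.mem_erase] at hu'
    by_cases huv : u = v₀
    · subst huv
      rw [hx₀, Submodule.mem_span_singleton] at hy
      obtain ⟨c, rfl⟩ := hy
      rw [omega_smul_right, omega_add_right, hu₁ x hx, hu₂ x hx, add_zero, mul_zero]
    · refine hu u ?_ x hx y hy
      simp only [Finset.mem_erase]
      exact ⟨hu'.1, hu'.2.1, huv, hu'.2.2.2⟩
  · rwa [Finset.erase_right_comm]

theorem IsMixed.subset {s t : Finset (Line n)} (h : IsMixed s) (hts : t ⊆ s)
    (ht : t.Nonempty) : IsStandard t ∨ IsTwoAdditive t ∨ IsSigma t ∨ IsMixed t := by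
  obtain ⟨v₀, v₁, v₂, v, w, hv₀, hv, hw₁, hw₂, hσ, hδ⟩ := h
  have sig : ∀ a, IsSigmaWith (s.erase a) v w → a ∉ t →
      IsStandard t ∨ IsTwoAdditive t ∨ IsSigma t ∨ IsMixed t := by
    intro a ha hat
    have := IsSigma.subset ⟨v, w, ha⟩ (Finset.subset_erase.2 ⟨hts, hat⟩) ht
    tauto
  by_cases h : v ∈ t
  swap
  · have := IsTwoAdditive.subset ⟨_, _, _, hδ⟩ (Finset.subset_erase.2 ⟨hts, h⟩) ht
    tauto
  by_cases h₀ : v₀ ∈ t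
  swap
  · exact sig v₀ hσ h₀
  by_cases h₁ : v₁ ∈ t
  swap
  · exact sig v₁ (isSigmaWith_erase_of_mixed hv₀ hσ hδ (Or.inl ⟨rfl, rfl⟩) hw₁ hw₂) h₁
  by_cases h₂ : v₂ ∈ t
  swap
  · exact sig v₂ (isSigmaWith_erase_of_mixed hv₀ hσ hδ (Or.inr ⟨rfl, rfl⟩) hw₂ hw₁) h₂
  have m1 := (Finset.mem_erase.1 hδ.2.1)
  have m2 := (Finset.mem_erase.1 hδ.2.2.1)
  have m2' := (Finset.mem_erase.1 m2.2)
  by_cases h' : w ∈ t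
  · refine Or.inr (Or.inr (Or.inr ⟨v₀, v₁, v₂, v, w, h₀, h, hw₁, hw₂, ?_, ?_⟩))
    · refine hσ.subset (Finset.erase_subset_erase _ hts) ?_ ?_
      · exact Finset.mem_erase.2 ⟨(Finset.mem_erase.1 hσ.1).1, h⟩
      · exact Finset.mem_erase.2
          ⟨(Finset.mem_erase.1 (Finset.mem_of_mem_erase hσ.2.1)).1, h'⟩
    · refine hδ.subset (Finset.erase_subset_erase _ hts) ?_ ?_ ?_
      · exact Finset.mem_erase.2 ⟨(Finset.mem_erase.1 hδ.1).1, h₀⟩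
      · exact Finset.mem_erase.2 ⟨(Finset.mem_erase.1 m1.2).1, h₁⟩
      · exact Finset.mem_erase.2 ⟨(Finset.mem_erase.1 m2'.2).1, h₂⟩
  · have hm1 : v₁ ∈ t.erase v₀ := Finset.mem_erase.2 ⟨m1.1, h₁⟩
    have hm2 : v₂ ∈ (t.erase v₀).erase v₁ :=
      Finset.mem_erase.2 ⟨m2.1, Finset.mem_erase.2 ⟨m2'.1, h₂⟩⟩
    refine Or.inr (Or.inl ⟨v₀, v₁, v₂, h₀, hm1, hm2, hδ.2.2.2.1,
      hσ.isStandard_erase.subset ?_ ⟨_, hm1⟩⟩)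
    rw [Finset.subset_erase]
    exact ⟨Finset.erase_subset_erase _ hts, fun h => h' (Finset.mem_of_mem_erase h)⟩

end

/-! ### The complexes `I^δ`, `IA` and the Tits building -/

/-- The complex `I^δ_n`: its simplices are the standard and the 2-additive simplices. -/
def IDelta (n : ℕ) : AbstractSimplicialComplex (Line n) where
  faces := {s | IsStandard s ∨ IsTwoAdditive s}
  isRelLowerSet_faces := by
    rintro s hs
    refine ⟨?_, fun t hts ht => ?_⟩
    · obtain hs | ⟨v, _, _, hs⟩ := hs
      exacts [hs.1, ⟨v, hs.1⟩]
    · obtain hs | hs := hs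
      exacts [Or.inl (hs.subset hts ht), hs.subset hts ht]
  singleton_mem := fun v => Or.inl (isStandard_singleton v)

/-- The complex `IA_n`: its simplices are the standard, 2-additive, `σ` and mixed simplices. -/
def IA (n : ℕ) : AbstractSimplicialComplex (Line n) where
  faces := {s | IsStandard s ∨ IsTwoAdditive s ∨ IsSigma s ∨ IsMixed s}
  isRelLowerSet_faces := by
    rintro s hs
    refine ⟨?_, fun t hts ht => ?_⟩
    · obtain hs | ⟨v, _, _, hs⟩ | ⟨v, _, hs⟩ | ⟨v, _, _, _, _, hs⟩ := hs
      exacts [hs.1, ⟨v, hs.1⟩, ⟨v, hs.1⟩, ⟨v, hs.1⟩]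
    · obtain hs | hs | hs | hs := hs
      · exact Or.inl (hs.subset hts ht)
      · exact (hs.subset hts ht).imp id Or.inl
      · exact (hs.subset hts ht).imp id fun h => Or.inr (Or.inl h)
      · exact hs.subset hts ht
  singleton_mem := fun v => Or.inl (isStandard_singleton v)

/-- The Tits building `T^ω_n`: nontrivial isotropic subspaces of `ℚ^{2n}`, ordered by inclusion.
(For `n ≥ 1` isotropic subspaces are proper.) -/
abbrev TitsBuilding (n : ℕ) : Type :=
  {V : Submodule ℚ (SymIdx n → ℚ) // V ≠ ⊥ ∧ IsIsotropic V}

/-- The symplectic Steinberg module `St^ω_n = H̃_{n-1}(T^ω_n; ℤ)`. -/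
abbrev Steinberg (n : ℕ) : Type := RedHomology (orderComplex (TitsBuilding n)) n

/-- The rational vector of an integral vector. -/
def toRat {n : ℕ} (x : SymIdx n → ℤ) : SymIdx n → ℚ := fun a => (x a : ℚ)

/-- The rational span `⟨Δ⟩_ℚ` of a finite set of lines. -/
def ratSpan {n : ℕ} (s : Finset (Line n)) : Submodule ℚ (SymIdx n → ℚ) :=
  Submodule.span ℚ (toRat '' (lineSpan s : Set (SymIdx n → ℤ)))

section
variable {n : ℕ}

theorem omega_toRat (x y : SymIdx n → ℤ) : omega (toRat x) (toRat y) = ((omega x y : ℤ) : ℚ) := by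
  simp [omega, toRat]

theorem toRat_injective : Function.Injective (toRat (n := n)) := fun x y h => by
  funext a
  exact Int.cast_injective (α := ℚ) (congrFun h a)

theorem Generates.ne_zero {x : SymIdx n → ℤ} {v : Line n} (h : Generates x v) : x ≠ 0 := by
  rintro rfl
  have h1 := v.2.2
  rw [h, Submodule.span_zero_singleton, finrank_bot] at h1
  exact zero_ne_one h1

theorem isIsotropic_lineSpan {s : Finset (Line n)} (hs : s ∈ (IDelta n).faces) :
    IsIsotropic (lineSpan s) := by
  obtain hs | ⟨v₀, v₁, v₂, hs⟩ := hs
  · exact hs.2.1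
  · rw [hs.isStandard_erase.2.2]
    exact hs.2.2.2.2.2.1

theorem ratSpan_mem {s : Finset (Line n)} (hs : s ∈ (IDelta n).faces) :
    ratSpan s ≠ ⊥ ∧ IsIsotropic (ratSpan s) := by
  constructor
  · obtain ⟨v, hv⟩ := ((IDelta n).isRelLowerSet_faces hs).1
    intro h
    have h1 : toRat (gen v) ∈ ratSpan s :=
      Submodule.subset_span ⟨gen v, le_lineSpan hv (generates_gen v).mem, rfl⟩
    rw [h, Submodule.mem_bot] at h1
    exact (generates_gen v).ne_zero (toRat_injective (h1.trans (by funext a; simp [toRat])))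
  · refine isIsotropic_span ?_
    rintro _ ⟨x, hx, rfl⟩ _ ⟨y, hy, rfl⟩
    rw [omega_toRat, isIsotropic_lineSpan hs x hx y hy, Int.cast_zero]

end

/-- The spanning map `s : P(I^δ_n) → T^ω_n`, `Δ ↦ ⟨Δ⟩_ℚ`. -/
def spanPosetMap (n : ℕ) : FacePoset (IDelta n) →o TitsBuilding n where
  toFun s := ⟨ratSpan s.1, ratSpan_mem s.2⟩
  monotone' := fun _ _ hst => Submodule.span_mono (Set.image_mono (lineSpan_mono hst))

/-- The map `s_* : H̃_{n-1}(P(I^δ_n)) → St^ω_n`. -/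
def spanMap (n : ℕ) : RedHomology (orderComplex (FacePoset (IDelta n))) n →ₗ[ℤ] Steinberg n :=
  redMap (orderComplexMap (spanPosetMap n)) n

/-! ### The complexes `∂β_n` and `β_n` and their fundamental classes -/

/-- Standard subsets of `{1, 1̄, …, n, n̄}`: nonempty subsets that contain no pair `{a, ā}`. -/
def IsStandardSubset {n : ℕ} (I : Finset (SymIdx n)) : Prop :=
  I.Nonempty ∧ ∀ a : Fin n, ¬(Sum.inl a ∈ I ∧ Sum.inr a ∈ I)

/-- `σ` subsets of `{1, 1̄, …, n, n̄}`: subsets that contain the pair `{n, n̄}` and no other pair. -/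
def IsSigmaSubset {n : ℕ} (I : Finset (SymIdx n)) : Prop :=
  (∃ l : Fin n, (l : ℕ) + 1 = n ∧ Sum.inl l ∈ I ∧ Sum.inr l ∈ I) ∧
    ∀ a : Fin n, (a : ℕ) + 1 < n → ¬(Sum.inl a ∈ I ∧ Sum.inr a ∈ I)

/-- The simplicial sphere `∂β_n`. -/
def bdryBeta (n : ℕ) : AbstractSimplicialComplex (SymIdx n) where
  faces := {I | IsStandardSubset I}
  isRelLowerSet_faces := fun _ hI =>
    ⟨hI.1, fun _ hJI hJ => ⟨hJ, fun a ha => hI.2 a ⟨hJI ha.1, hJI ha.2⟩⟩⟩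
  singleton_mem := fun v => ⟨Finset.singleton_nonempty v, fun a ha => by
    have h1 := Finset.mem_singleton.1 ha.1
    have h2 := Finset.mem_singleton.1 ha.2
    rw [← h2] at h1
    cases h1⟩

/-- The simplicial disc `β_n`. -/
def beta (n : ℕ) : AbstractSimplicialComplex (SymIdx n) where
  faces := {I | IsStandardSubset I ∨ IsSigmaSubset I}
  isRelLowerSet_faces := by
    rintro I hI
    refine ⟨?_, fun J hJI hJ => ?_⟩
    · obtain hI | ⟨⟨l, _, hl, _⟩, _⟩ := hI
      exacts [hI.1, ⟨_, hl⟩]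
    · obtain hI | ⟨_, hI⟩ := hI
      · exact Or.inl ⟨hJ, fun a ha => hI.2 a ⟨hJI ha.1, hJI ha.2⟩⟩
      · by_cases h : ∃ l : Fin n, (l : ℕ) + 1 = n ∧ Sum.inl l ∈ J ∧ Sum.inr l ∈ J
        · exact Or.inr ⟨h, fun a ha ha' => hI a ha ⟨hJI ha'.1, hJI ha'.2⟩⟩
        · refine Or.inl ⟨hJ, fun a ha => ?_⟩
          by_cases h' : (a : ℕ) + 1 < n
          · exact hI a h' ⟨hJI ha.1, hJI ha.2⟩
          · exact h ⟨a, by omega, ha⟩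
  singleton_mem := fun v => Or.inl ((bdryBeta n).singleton_mem v)

theorem bdryBeta_le_beta (n : ℕ) : bdryBeta n ≤ beta n := fun _ h => Or.inl h

theorem cone_mem_chains {ι : Type*} {X Y : AbstractSimplicialComplex ι} {a : ι}
    (h : ∀ s ∈ X.faces, ∃ u ∈ Y.faces, a ∈ u ∧ s ⊆ u) {k : ℕ} {c : Chains ι k}
    (hc : c ∈ chains X k) : cone a k c ∈ chains Y (k + 1) := by
  have : chains X k ≤ (chains Y (k + 1)).comap (cone a k) := by
    rw [chains_le_iff]
    intro t ht
    rw [Submodule.mem_comap, cone_single]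
    refine single_mem_chains Y ?_ _
    obtain rfl | ⟨s, hs, hst⟩ := ht
    · refine Or.inr ⟨{a}, Y.singleton_mem a, fun i => ?_⟩
      refine Fin.cases ?_ (fun j => j.elim0) i
      simp
    · obtain ⟨u, hu, hau, hsu⟩ := h s hs
      refine Or.inr ⟨u, hu, fun i => ?_⟩
      refine Fin.cases ?_ (fun j => ?_) i
      · simpa using hau
      · simpa using hsu (hst j)
  exact this hc

/-- `β_n` is a cone with apex `n`, for `n ≥ 1`. -/
theorem beta_cone (n : ℕ) (hn : 1 ≤ n) : ∀ s ∈ (beta n).faces, ∃ u ∈ (beta n).faces,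
    (Sum.inl ⟨n - 1, by omega⟩ : SymIdx n) ∈ u ∧ s ⊆ u := by
  intro s hs
  refine ⟨insert (Sum.inl ⟨n - 1, by omega⟩) s, ?_, Finset.mem_insert_self _ _,
    Finset.subset_insert _ _⟩
  have key : ∀ a : Fin n, (a : ℕ) + 1 < n →
      ¬(Sum.inl a ∈ insert (Sum.inl ⟨n - 1, by omega⟩ : SymIdx n) s ∧
        Sum.inr a ∈ insert (Sum.inl ⟨n - 1, by omega⟩ : SymIdx n) s) := by
    intro a ha hm
    rw [Finset.mem_insert, Finset.mem_insert] at hm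
    have h1 : Sum.inl a ∈ s := hm.1.resolve_left fun h => by
      have := congrArg Fin.val (Sum.inl_injective h)
      simp only at this
      omega
    have h2 : Sum.inr a ∈ s := hm.2.resolve_left (by simp)
    obtain hs | hs := hs
    · exact hs.2 a ⟨h1, h2⟩
    · exact hs.2 a ha ⟨h1, h2⟩
  by_cases h : (Sum.inr ⟨n - 1, by omega⟩ : SymIdx n) ∈ s
  · refine Or.inr ⟨⟨⟨n - 1, by omega⟩, by simp only; omega, Finset.mem_insert_self _ _,
      Finset.mem_insert_of_mem h⟩, key⟩
  · refine Or.inl ⟨Finset.insert_nonempty _ _, fun a ha => ?_⟩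
    by_cases h' : (a : ℕ) + 1 < n
    · exact key a h' ha
    · have : a = ⟨n - 1, by omega⟩ := Fin.ext (by simp only; omega)
      rw [this] at ha
      exact h ((Finset.mem_insert.1 ha.2).resolve_left (by simp))

/-- In a complex that is a cone, every reduced cycle bounds its cone. -/
theorem bdry_cone_of_cycle {ι : Type*} {X : AbstractSimplicialComplex ι} {a : ι} {k : ℕ}
    {c : Chains ι k} (hc : c ∈ cycles X k) : bdry k (cone a k c) = c := by
  cases k with
  | zero => exact bdry_cone_zero a c
  | succ k =>
    have h : bdry k c = 0 := hc.2
    rw [bdry_cone_succ, h, map_zero, sub_zero]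

/-- The connecting morphism of the disc `(β_n, ∂β_n)` is an isomorphism. -/
theorem connecting_beta_bijective (n : ℕ) (hn : 1 ≤ n) :
    Function.Bijective (connecting (beta n) (bdryBeta n) n) := by
  constructor
  · rw [injective_iff_map_eq_zero]
    intro x
    obtain ⟨⟨c, hc⟩, rfl⟩ := Submodule.Quotient.mk_surjective _ x
    intro h
    have h' : bdry n c ∈ boundaries (bdryBeta n) n :=
      (Submodule.Quotient.mk_eq_zero
        ((boundaries (bdryBeta n) n).submoduleOf (cycles (bdryBeta n) n))).1
        (show Submodule.Quotient.mk (⟨bdry n c, bdry_mem_cycles _ hc.2⟩ :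
          cycles (bdryBeta n) n) = 0 from h)
    obtain ⟨a, ha, hac⟩ := h'
    refine (Submodule.Quotient.mk_eq_zero _).2 ?_
    change c ∈ relBoundaries (beta n) (bdryBeta n) n
    have hz : c - a ∈ cycles (beta n) (n + 1) :=
      ⟨Submodule.sub_mem _ hc.1 (chains_mono (bdryBeta_le_beta n) _ ha), by
        change bdry n (c - a) = 0
        rw [map_sub, hac, sub_self]⟩
    have e : c = bdry (n + 1) (cone (Sum.inl ⟨n - 1, by omega⟩) (n + 1) (c - a)) + a := by
      rw [bdry_cone_of_cycle hz, sub_add_cancel]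
    rw [e]
    exact Submodule.add_mem_sup ⟨_, cone_mem_chains (beta_cone n hn) hz.1, rfl⟩ ha
  · intro x
    obtain ⟨⟨z, hz⟩, rfl⟩ := Submodule.Quotient.mk_surjective _ x
    have e : bdry n (cone (Sum.inl ⟨n - 1, by omega⟩) n z) = z := bdry_cone_of_cycle hz
    have hz' := cycles_le_chains _ _ hz
    have hmem : cone (Sum.inl ⟨n - 1, by omega⟩) n z ∈ relCycles (beta n) (bdryBeta n) n := by
      refine ⟨cone_mem_chains (beta_cone n hn) (chains_mono (bdryBeta_le_beta n) _ hz'), ?_⟩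
      change bdry n _ ∈ chains (bdryBeta n) n
      rw [e]
      exact hz'
    refine ⟨Submodule.Quotient.mk ⟨_, hmem⟩, ?_⟩
    have e' : (⟨bdry n _, bdry_mem_cycles _ hmem.2⟩ : cycles (bdryBeta n) n) = ⟨z, hz⟩ :=
      Subtype.ext e
    rw [← e']
    rfl

/-- The connecting isomorphism `H_n(β_n, ∂β_n) ≅ H̃_{n-1}(∂β_n)` for `n ≥ 1`. -/
def connectingBeta (n : ℕ) (hn : 1 ≤ n) :
    RelHomology (beta n) (bdryBeta n) n ≃ₗ[ℤ] RedHomology (bdryBeta n) n :=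
  LinearEquiv.ofBijective (connecting (beta n) (bdryBeta n) n) (connecting_beta_bijective n hn)

/-- The inclusion `{1, 1̄, …, n, n̄} ⊆ {1, 1̄, …, n + 1, (n + 1)‾}`. -/
def symIncl (n : ℕ) : SymIdx n → SymIdx (n + 1) := Sum.map Fin.castSucc Fin.castSucc

/-- The inclusion `∂β_n → ∂β_{n+1}`. -/
def bdryBetaIncl (n : ℕ) : SimplicialMap (bdryBeta n) (bdryBeta (n + 1)) where
  toFun := symIncl n
  image_mem := fun I hI => by
    refine ⟨I.image (symIncl n), ⟨hI.1.image _, fun a ha => ?_⟩, Finset.coe_image⟩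
    obtain ⟨x, hx, hxa⟩ := Finset.mem_image.1 ha.1
    obtain ⟨y, hy, hya⟩ := Finset.mem_image.1 ha.2
    obtain x | x := x <;> obtain y | y := y <;> simp [symIncl] at hxa hya
    have : x = y := Fin.castSucc_injective _ (hxa.trans hya.symm)
    subst this
    exact hI.2 x ⟨hx, hy⟩

/-- On chains, the suspension `z ↦ N * z - S * z` with the suspension points `N = n + 1` and
`S = (n + 1)‾` of `∂β_{n+1} = ∂β_n * {N, S}`. -/
def suspendChain (n k : ℕ) : Chains (SymIdx n) k →ₗ[ℤ] Chains (SymIdx (n + 1)) (k + 1) :=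
  (cone (Sum.inl (Fin.last n)) k - cone (Sum.inr (Fin.last n)) k).comp (push (symIncl n) k)

theorem suspendChain_mem (n k : ℕ) {c : Chains (SymIdx n) k} (hc : c ∈ chains (bdryBeta n) k) :
    suspendChain n k c ∈ chains (bdryBeta (n + 1)) (k + 1) := by
  -- the image of `∂β_n` is contained in the subcomplex of simplices without suspension points
  have hb : ∀ N : SymIdx (n + 1), (N = Sum.inl (Fin.last n) ∨ N = Sum.inr (Fin.last n)) →
      cone N k (push (symIncl n) k c) ∈ chains (bdryBeta (n + 1)) (k + 1) := by
    intro N hN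
    have : chains (bdryBeta n) k ≤ (chains (bdryBeta (n + 1)) (k + 1)).comap
        ((cone N k).comp (push (symIncl n) k)) := by
      rw [chains_le_iff]
      intro t ht
      rw [Submodule.mem_comap, LinearMap.comp_apply, push_single, cone_single]
      refine single_mem_chains _ ?_ _
      have hmem : ∀ I : Finset (SymIdx n), (∀ a : Fin n, ¬(Sum.inl a ∈ I ∧ Sum.inr a ∈ I)) →
          insert N (I.image (symIncl n)) ∈ (bdryBeta (n + 1)).faces := by
        intro I hI
        refine ⟨Finset.insert_nonempty _ _, fun a ha => ?_⟩
        rw [Finset.mem_insert, Finset.mem_insert, Finset.mem_image, Finset.mem_image] at ha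
        obtain ⟨h1, h2⟩ := ha
        refine Fin.lastCases (fun h1 h2 => ?_) (fun b h1 h2 => ?_) a h1 h2
        · have e1 : ¬∃ x ∈ I, symIncl n x = Sum.inl (Fin.last n) := by
            rintro ⟨x | x, _, hx⟩ <;> simp [symIncl, Fin.ext_iff] at hx
            have := x.2
            omega
          have e2 : ¬∃ x ∈ I, symIncl n x = Sum.inr (Fin.last n) := by
            rintro ⟨x | x, _, hx⟩ <;> simp [symIncl, Fin.ext_iff] at hx
            have := x.2
            omega
          have := (h1.resolve_right e1).trans (h2.resolve_right e2).symm
          cases this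
        · have e1 : (Sum.inl b.castSucc : SymIdx (n + 1)) ≠ N := by
            rintro rfl
            simp [Fin.ext_iff] at hN
            have := b.2
            omega
          have e2 : (Sum.inr b.castSucc : SymIdx (n + 1)) ≠ N := by
            rintro rfl
            simp [Fin.ext_iff] at hN
            have := b.2
            omega
          obtain ⟨x, hx, hxb⟩ := h1.resolve_left e1
          obtain ⟨y, hy, hyb⟩ := h2.resolve_left e2
          obtain x | x := x <;> obtain y | y := y <;> simp [symIncl] at hxb hyb
          rw [hxb] at hx
          rw [hyb] at hy
          exact hI b ⟨hx, hy⟩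
      obtain rfl | ⟨s, hs, hst⟩ := ht
      · refine Or.inr ⟨_, hmem ∅ (by simp), fun i => ?_⟩
        refine Fin.cases ?_ (fun j => j.elim0) i
        simp
      · refine Or.inr ⟨_, hmem s hs.2, fun i => ?_⟩
        refine Fin.cases ?_ (fun j => ?_) i
        · simp
        · rw [Fin.cons_succ]
          exact Finset.mem_insert_of_mem (Finset.mem_image_of_mem _ (hst j))
    exact this hc
  rw [suspendChain, LinearMap.comp_apply, LinearMap.sub_apply]
  exact Submodule.sub_mem _ (hb _ (Or.inl rfl)) (hb _ (Or.inr rfl))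

theorem bdry_suspendChain (n k : ℕ) (c : Chains (SymIdx n) (k + 1)) :
    bdry (k + 1) (suspendChain n (k + 1) c) = -suspendChain n k (bdry k c) := by
  simp only [suspendChain, LinearMap.comp_apply, LinearMap.sub_apply, map_sub, bdry_cone_succ,
    bdry_push]
  abel

/-- The suspension isomorphism `H̃_{n-1}(∂β_n) → H̃_n(∂β_{n+1})`. -/
def suspension (n : ℕ) : RedHomology (bdryBeta n) n →ₗ[ℤ] RedHomology (bdryBeta (n + 1)) (n + 1) :=
  Submodule.mapQ _ _
    ((suspendChain n n).restrict (p := cycles (bdryBeta n) n)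
      (q := cycles (bdryBeta (n + 1)) (n + 1)) fun c hc =>
        ⟨suspendChain_mem n n (cycles_le_chains _ _ hc), by
          change bdry n _ = 0
          rw [suspendChain, LinearMap.comp_apply, LinearMap.sub_apply, map_sub,
            bdry_cone_of_cycle (show push (symIncl n) n c ∈ cycles (bdryBeta (n + 1)) n from
              push_mem_cycles (bdryBetaIncl n) hc),
            bdry_cone_of_cycle (show push (symIncl n) n c ∈ cycles (bdryBeta (n + 1)) n from
              push_mem_cycles (bdryBetaIncl n) hc), sub_self]⟩)
    (by
      rintro ⟨c, hc⟩ ⟨x, hx, hxc⟩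
      refine ⟨-suspendChain n (n + 1) x,
        Submodule.neg_mem _ (suspendChain_mem n (n + 1) hx), ?_⟩
      rw [map_neg, bdry_suspendChain, neg_neg, hxc]
      rfl)

/-- The fundamental class `ξ_{n-1} ∈ H̃_{n-1}(∂β_n)` for `n ≥ 1`, obtained by suspension from a
fundamental class `ξ₀ ∈ H̃_0(∂β_1)`. (The value for `n = 0` is not used.) -/
def fundamentalClass (ξ₀ : RedHomology (bdryBeta 1) 1) : (n : ℕ) → RedHomology (bdryBeta n) n
  | 0 => 0
  | 1 => ξ₀
  | n + 2 => suspension (n + 1) (fundamentalClass ξ₀ (n + 1))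

/-! ### Symplectic matrices, apartments and the maps of the diagram -/

/-- The integral symplectic group `Sp_{2n}(ℤ)`. -/
abbrev Sp (n : ℕ) : Type := Matrix.symplecticGroup (Fin n) ℤ

/-- The column vector of `M` with index `a`. -/
def column {n : ℕ} (M : Sp n) (a : SymIdx n) : SymIdx n → ℤ := fun b => M.1 b a

section
variable {n : ℕ}

theorem omega_eq_dotProduct {R : Type*} [CommRing R] (x y : SymIdx n → R) :
    omega x y = -(x ⬝ᵥ (Matrix.J (Fin n) R).mulVec y) := by
  simp [omega, Matrix.J, Matrix.mulVec, dotProduct, Matrix.fromBlocks, Fintype.sum_sum_type,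
    Matrix.one_apply, Finset.sum_sub_distrib]
  ring

theorem omega_column (M : Sp n) (a b : SymIdx n) :
    omega (column M a) (column M b) = -(Matrix.J (Fin n) ℤ a b) := by
  rw [omega_eq_dotProduct]
  congr 1
  have h := SymplecticGroup.mem_iff'.1 M.2
  have h' := congrFun (congrFun h a) b
  rw [← h', Matrix.mul_assoc, Matrix.mul_apply]
  rfl

/-- The conjugate index `a ↦ ā`. -/
def bar : SymIdx n → SymIdx n := Sum.swap

theorem omega_column_of_ne (M : Sp n) {a b : SymIdx n} (h : b ≠ bar a) :
    omega (column M a) (column M b) = 0 := by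
  rw [omega_column, neg_eq_zero]
  obtain a | a := a <;> obtain b | b := b <;>
    simp [bar, Matrix.J] at h ⊢
  · exact Matrix.one_apply_ne (Ne.symm h)
  · exact Matrix.one_apply_ne (Ne.symm h)

theorem omega_column_bar (M : Sp n) (a : SymIdx n) :
    omega (column M a) (column M (bar a)) = 1 ∨ omega (column M a) (column M (bar a)) = -1 := by
  rw [omega_column]
  obtain a | a := a <;> simp [bar, Matrix.J]

theorem bar_bar (a : SymIdx n) : bar (bar a) = a := Sum.swap_swap a

theorem exists_dual_column (M : Sp n) (a : SymIdx n) : ∃ φ : (SymIdx n → ℤ) →ₗ[ℤ] ℤ,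
    φ (column M a) = 1 ∧ ∀ b, b ≠ a → φ (column M b) = 0 := by
  refine ⟨omega (column M a) (column M (bar a)) • omegaLeft (column M (bar a)), ?_, ?_⟩
  · change omega (column M a) (column M (bar a)) * omega (column M a) (column M (bar a)) = 1
    obtain h | h := omega_column_bar M a <;> rw [h] <;> rfl
  · intro b hb
    change omega (column M a) (column M (bar a)) * omega (column M b) (column M (bar a)) = 0
    rw [omega_column_of_ne M (a := b), mul_zero]
    intro h
    exact hb (by rw [← bar_bar b, ← h, bar_bar])

end

/-- The line `⟨M_a⟩_ℤ` spanned by a column of `M`. -/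
def columnLine {n : ℕ} (M : Sp n) (a : SymIdx n) : Line n :=
  ⟨Submodule.span ℤ {column M a}, by
    obtain ⟨φ, h1, -⟩ := exists_dual_column M a
    have := summand_of_dual (s := {a}) (g := column M) (φ := fun _ => φ)
      (fun v hv => by rw [Finset.mem_singleton.1 hv, h1])
      (fun v hv w hw h =>
        (h ((Finset.mem_singleton.1 hv).trans (Finset.mem_singleton.1 hw).symm)).elim)
    rwa [Finset.coe_singleton, Set.image_singleton, Finset.card_singleton] at this⟩

section
variable {n : ℕ}

theorem generates_column (M : Sp n) (a : SymIdx n) : Generates (column M a) (columnLine M a) := rfl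

theorem columnLine_injective (M : Sp n) : Function.Injective (columnLine M) := by
  intro a b h
  by_contra hab
  obtain ⟨φ, h1, h0⟩ := exists_dual_column M a
  have : column M a ∈ (columnLine M b).1 := h ▸ (generates_column M a).mem
  rw [generates_column M b, Submodule.mem_span_singleton] at this
  obtain ⟨c, hc⟩ := this
  rw [← hc, map_smul, h0 b (Ne.symm hab), smul_zero] at h1
  exact zero_ne_one h1

theorem isStandard_columns (M : Sp n) {I : Finset (SymIdx n)} (hI : IsStandardSubset I) :
    IsStandard (I.image (columnLine M)) := by
  choose φ h1 h0 using exists_dual_column M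
  have : Nonempty (SymIdx n) := ⟨hI.1.choose⟩
  have inv : ∀ a, Function.invFun (columnLine M) (columnLine M a) = a :=
    Function.leftInverse_invFun (columnLine_injective M)
  have hbar : ∀ a ∈ I, ∀ b ∈ I, b ≠ bar a := by
    rintro (a | a) ha _ hb rfl
    · exact hI.2 a ⟨ha, hb⟩
    · exact hI.2 a ⟨hb, ha⟩
  refine isStandard_of_dual (g := fun v => column M (Function.invFun (columnLine M) v))
    (φ := fun v => φ (Function.invFun (columnLine M) v)) (hI.1.image _) ?_ ?_ ?_ ?_
  · intro v hv
    obtain ⟨a, _, rfl⟩ := Finset.mem_image.1 hv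
    simp only [inv]
    exact generates_column M a
  · intro v hv w hw
    obtain ⟨a, ha, rfl⟩ := Finset.mem_image.1 hv
    obtain ⟨b, hb, rfl⟩ := Finset.mem_image.1 hw
    simp only [inv]
    exact omega_column_of_ne M (hbar a ha b hb)
  · intro v hv
    obtain ⟨a, _, rfl⟩ := Finset.mem_image.1 hv
    simp only [inv]
    exact h1 a
  · intro v hv w hw hvw
    obtain ⟨a, ha, rfl⟩ := Finset.mem_image.1 hv
    obtain ⟨b, hb, rfl⟩ := Finset.mem_image.1 hw
    simp only [inv]
    exact h0 a b fun h => hvw (by rw [h])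

theorem isSigma_columns (M : Sp n) {I : Finset (SymIdx n)} (hI : IsSigmaSubset I) :
    IsSigma (I.image (columnLine M)) := by
  obtain ⟨⟨l, hl, hl1, hl2⟩, hI⟩ := hI
  have inj := columnLine_injective M
  refine ⟨columnLine M (Sum.inr l), columnLine M (Sum.inl l), Finset.mem_image_of_mem _ hl2, ?_,
    ⟨_, _, generates_column M _, generates_column M _, omega_column_bar M (Sum.inr l)⟩, ?_, ?_⟩
  · refine Finset.mem_erase.2 ⟨fun h => ?_, Finset.mem_image_of_mem _ hl1⟩
    exact Sum.inl_ne_inr (inj h)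
  · intro u hu x hx y hy
    simp only [Finset.mem_erase] at hu
    obtain ⟨b, hb, rfl⟩ := Finset.mem_image.1 hu.2.2
    rw [generates_column M, Submodule.mem_span_singleton] at hx hy
    obtain ⟨c, rfl⟩ := hx
    obtain ⟨d, rfl⟩ := hy
    rw [omega_smul_left, omega_smul_right, omega_column_of_ne M, mul_zero, mul_zero]
    rintro rfl
    exact hu.1 rfl
  · have : (I.image (columnLine M)).erase (columnLine M (Sum.inr l)) =
        (I.erase (Sum.inr l)).image (columnLine M) := by
      rw [Finset.image_erase inj]
    rw [this]
    refine isStandard_columns M ⟨⟨Sum.inl l, Finset.mem_erase.2 ⟨by simp, hl1⟩⟩, fun a ha => ?_⟩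
    by_cases h : (a : ℕ) + 1 < n
    · exact hI a h ⟨Finset.mem_of_mem_erase ha.1, Finset.mem_of_mem_erase ha.2⟩
    · have : a = l := Fin.ext (by omega)
      subst this
      exact (Finset.mem_erase.1 ha.2).1 rfl

end

/-- The simplicial map `M^α : β_n → IA_n`, `a ↦ ⟨M_a⟩_ℤ`. -/
def discMap {n : ℕ} (M : Sp n) : SimplicialMap (beta n) (IA n) where
  toFun := columnLine M
  image_mem := fun I hI => ⟨I.image (columnLine M),
    hI.elim (fun h => Or.inl (isStandard_columns M h))
      fun h => Or.inr (Or.inr (Or.inl (isSigma_columns M h))), Finset.coe_image⟩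

/-- The simplicial map `∂M^α : ∂β_n → I^δ_n`, the restriction of `M^α`. -/
def sphereMap {n : ℕ} (M : Sp n) : SimplicialMap (bdryBeta n) (IDelta n) where
  toFun := columnLine M
  image_mem := fun I hI =>
    ⟨I.image (columnLine M), Or.inl (isStandard_columns M hI), Finset.coe_image⟩

/-- The poset map `∂M : P(∂β_n) → T^ω_n`, `I ↦ M_I = ⟨M_a : a ∈ I⟩_ℚ`. -/
def apartmentMap {n : ℕ} (M : Sp n) : FacePoset (bdryBeta n) →o TitsBuilding n where
  toFun I := ⟨Submodule.span ℚ ((fun a => toRat (column M a)) '' (I.1 : Set (SymIdx n))), by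
    obtain ⟨I, hI⟩ := I
    constructor
    · obtain ⟨a, ha⟩ := hI.1
      intro h
      have h1 : toRat (column M a) ∈
          Submodule.span ℚ ((fun a => toRat (column M a)) '' (I : Set (SymIdx n))) :=
        Submodule.subset_span ⟨a, ha, rfl⟩
      rw [h, Submodule.mem_bot] at h1
      exact (generates_column M a).ne_zero
        (toRat_injective (h1.trans (by funext a; simp [toRat])))
    · refine isIsotropic_span ?_
      rintro _ ⟨a, ha, rfl⟩ _ ⟨b, hb, rfl⟩
      change omega (toRat (column M a)) (toRat (column M b)) = 0
      rw [omega_toRat, omega_column_of_ne M, Int.cast_zero]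
      rintro rfl
      obtain a | a := a
      · exact hI.2 a ⟨ha, hb⟩
      · exact hI.2 a ⟨hb, ha⟩⟩
  monotone' := fun _ _ hIJ => Submodule.span_mono (Set.image_mono (Finset.coe_subset.2 hIJ))

/-- The `ℤ`-linear extension to the group ring `ℤ[Sp_{2n}(ℤ)]` of a map on `Sp_{2n}(ℤ)`. -/
def extendLinearly {n : ℕ} {A : Type*} [AddCommGroup A] (f : Sp n → A) :
    MonoidAlgebra ℤ (Sp n) →ₗ[ℤ] A :=
  (Finsupp.linearCombination ℤ f).comp (MonoidAlgebra.coeffLinearEquiv ℤ).toLinearMap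

/-- The symplectic integral apartment class map `[-] : ℤ[Sp_{2n}(ℤ)] → St^ω_n`,
`[M] = ∂M_*(b(ξ))`. -/
def apartmentClassMap (n : ℕ) (ξ₀ : RedHomology (bdryBeta 1) 1) :
    MonoidAlgebra ℤ (Sp n) →ₗ[ℤ] Steinberg n :=
  extendLinearly fun M => redMap (orderComplexMap (apartmentMap M)) n
    (subdivision (bdryBeta n) n (fundamentalClass ξ₀ n))

/-- The map `α : ℤ[Sp_{2n}(ℤ)] → H_n(IA_n, I^δ_n)`: the image of `ξ ∈ H̃_{n-1}(∂β_n)` under the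
inverse of the connecting isomorphism of `(β_n, ∂β_n)`, followed by `(M^α, ∂M^α)_*`. -/
def alpha (n : ℕ) (hn : 1 ≤ n) (ξ₀ : RedHomology (bdryBeta 1) 1) :
    MonoidAlgebra ℤ (Sp n) →ₗ[ℤ] RelHomology (IA n) (IDelta n) n :=
  extendLinearly fun M => relMap (discMap M) (sphereMap M) rfl n
    ((connectingBeta n hn).symm (fundamentalClass ξ₀ n))

end SymplecticApartments

end

open SymplecticApartments

noncomputable section

namespace SymplecticApartments

/-! ### Chain homotopies obtained by coning inside a carrier -/

section
variable {ι κ : Type*}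

/-! The statement about `b` has nothing to do with symplectic geometry: for every simplicial complex
`X`, subdivision is an isomorphism in every degree (`subdivision_bijective`). Choosing a vertex of
each simplex gives a simplicial map `P(X) → X`, because the simplices of a flag all lie in its
largest member, and this map induces the inverse of `b`.

Both composites are compared with the identity by the method of carriers
(`sub_mem_boundaries_of_carrier`). To each tuple is attached a family of tuples that supports both
images, that contains the families of its faces, and that is closed under putting one fixed apex in
front. Coning from the apices then builds, degree by degree, a homotopy `D` with `∂D + D∂ = f - g`.
For `X → P(X) → X` the carrier of a tuple is the full simplex on its entries, with any entry as
apex. For `P(X) → X → P(X)` the carrier of a flag consists of the flags of simplices that lie below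
an entry of the given one, and the apex is the largest entry.

The factorization is checked on one matrix `M`. The disc map of `M` restricts to its sphere map
`∂β_n → I^δ_n`, and the fundamental class of the disc has boundary `ξ`; naturality of the connecting
morphism (`connecting_relMap`) therefore identifies `δ(α(M))` with the image of `ξ` under the sphere
map. Naturality of subdivision (`subdivision_redMap`) turns `b` on `I^δ_n` into `b` on `∂β_n`. What
remains is an equality of poset maps `P(∂β_n) → T^ω_n` (`spanPosetMap_comp_faceMap`): the rational
span of the lines `⟨M_a⟩` is the span of the columns themselves. -/

/-- The chain homotopy built by coning off from the apices `a t`. -/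
def coneHomotopy (f g : ∀ k, Chains ι k →ₗ[ℤ] Chains κ k) (a : ∀ k, (Fin (k + 1) → ι) → κ) :
    (k : ℕ) → Chains ι k →ₗ[ℤ] Chains κ (k + 1)
  | 0 => 0
  | k + 1 => Finsupp.linearCombination ℤ fun t : Fin (k + 1) → ι =>
      cone (a k t) (k + 1) (f (k + 1) (Finsupp.single t 1) - g (k + 1) (Finsupp.single t 1) -
        coneHomotopy f g a k (bdry k (Finsupp.single t 1)))

theorem coneHomotopy_single (f g : ∀ k, Chains ι k →ₗ[ℤ] Chains κ k)
    (a : ∀ k, (Fin (k + 1) → ι) → κ) (k : ℕ) (t : Fin (k + 1) → ι) :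
    coneHomotopy f g a (k + 1) (Finsupp.single t 1) =
      cone (a k t) (k + 1) (f (k + 1) (Finsupp.single t 1) - g (k + 1) (Finsupp.single t 1) -
        coneHomotopy f g a k (bdry k (Finsupp.single t 1))) := by
  rw [coneHomotopy, Finsupp.linearCombination_single, one_smul]

/-- The chain that gets coned, `f t - g t - D∂t`, is a cycle: by induction `∂D∂t = f∂t - g∂t -
D∂∂t`, and `∂∂t = 0`. The boundary of a cone over a cycle is the cycle itself, whatever the apex.
The complex `X` enters only because `f` and `g` are chain maps on `chains X` alone. -/
theorem bdry_coneHomotopy {X : AbstractSimplicialComplex ι}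
    {f g : ∀ k, Chains ι k →ₗ[ℤ] Chains κ k} (a : ∀ k, (Fin (k + 1) → ι) → κ) (h0 : f 0 = g 0)
    (hf : ∀ k, ∀ c ∈ chains X (k + 1), bdry k (f (k + 1) c) = f k (bdry k c))
    (hg : ∀ k, ∀ c ∈ chains X (k + 1), bdry k (g (k + 1) c) = g k (bdry k c))
    (k : ℕ) {c : Chains ι (k + 1)} (hc : c ∈ chains X (k + 1)) :
    bdry (k + 1) (coneHomotopy f g a (k + 1) c) =
      f (k + 1) c - g (k + 1) c - coneHomotopy f g a k (bdry k c) := by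
  induction k with
  | zero =>
    -- Both sides are linear, so it is enough that their equalizer contains every spanning tuple.
    have : chains X 1 ≤ LinearMap.eqLocus ((bdry 1).comp (coneHomotopy f g a 1))
        (f 1 - g 1 - (coneHomotopy f g a 0).comp (bdry 0)) := by
      rw [chains_le_iff]
      intro t ht
      have hs := single_mem_chains X ht 1
      -- Here being a cycle means having augmentation zero, which is the agreement `h0` on the empty
      -- tuple.
      rw [LinearMap.mem_eqLocus, LinearMap.comp_apply, coneHomotopy_single, bdry_cone_succ,
        map_sub, map_sub (bdry 0), hf 0 _ hs, hg 0 _ hs, h0]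
      simp [coneHomotopy]
    exact this hc
  | succ k ih =>
    have : chains X (k + 2) ≤ LinearMap.eqLocus ((bdry (k + 2)).comp (coneHomotopy f g a (k + 2)))
        (f (k + 2) - g (k + 2) - (coneHomotopy f g a (k + 1)).comp (bdry (k + 1))) := by
      rw [chains_le_iff]
      intro t ht
      have hs := single_mem_chains X ht 1
      rw [LinearMap.mem_eqLocus, LinearMap.comp_apply, coneHomotopy_single, bdry_cone_succ,
        map_sub, map_sub (bdry (k + 1)), hf _ _ hs, hg _ _ hs, ih (bdry_mem_chains X hs), bdry_bdry, map_zero]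
      simp
    exact this hc

/-- The homotopy between two chain maps with a common carrier stays in the carrier. -/
theorem coneHomotopy_mem_supported {X : AbstractSimplicialComplex ι}
    {f g : ∀ k, Chains ι k →ₗ[ℤ] Chains κ k} {a : ∀ k, (Fin (k + 1) → ι) → κ}
    {K : ∀ {k : ℕ}, (Fin k → ι) → ∀ m : ℕ, Set (Fin m → κ)}
    (hK : ∀ k (t : Fin (k + 1) → ι), Spans X t → ∀ (i : Fin (k + 1)) m,
      K (fun j : Fin k => t (i.succAbove j)) m ⊆ K t m)
    (ha : ∀ k (t : Fin (k + 1) → ι), Spans X t → ∀ m, ∀ u ∈ K t m,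
      (Fin.cons (a k t) u : Fin (m + 1) → κ) ∈ K t (m + 1))
    (hf : ∀ k (t : Fin (k + 1) → ι), Spans X t →
      f (k + 1) (Finsupp.single t 1) ∈ Finsupp.supported ℤ ℤ (K t (k + 1)))
    (hg : ∀ k (t : Fin (k + 1) → ι), Spans X t →
      g (k + 1) (Finsupp.single t 1) ∈ Finsupp.supported ℤ ℤ (K t (k + 1)))
    (k : ℕ) (t : Fin k → ι) (ht : Spans X t) :
    coneHomotopy f g a k (Finsupp.single t 1) ∈ Finsupp.supported ℤ ℤ (K t (k + 1)) := by
  induction k with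
  | zero => exact Submodule.zero_mem _
  | succ k ih =>
    -- By `ha`, coning from the apex of `t` does not leave the carrier of `t`.
    have hcone : Finsupp.supported ℤ ℤ (K t (k + 1)) ≤
        (Finsupp.supported ℤ ℤ (K t (k + 2))).comap (cone (a k t) (k + 1)) := by
      rw [Finsupp.supported_eq_span_single, Submodule.span_le]
      rintro _ ⟨u, hu, rfl⟩
      rw [SetLike.mem_coe, Submodule.mem_comap, cone_single]
      exact Finsupp.single_mem_supported ℤ _ (ha k t ht _ u hu)
    rw [coneHomotopy_single]
    refine hcone (Submodule.sub_mem _ (Submodule.sub_mem _ (hf k t ht) (hg k t ht)) ?_)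
    -- The correction term `D∂t` lies in the carriers of the faces of `t`, hence in that of `t` by
    -- `hK`. The signs are pulled out because the induction hypothesis concerns coefficient `1`.
    rw [bdry_single, map_sum]
    refine Submodule.sum_mem _ fun i _ => ?_
    have h1 : Finsupp.single (fun j : Fin k => t (i.succAbove j)) ((-1 : ℤ) ^ (i : ℕ)) =
        ((-1 : ℤ) ^ (i : ℕ)) • Finsupp.single (fun j : Fin k => t (i.succAbove j)) (1 : ℤ) := by
      simp
    rw [h1, map_smul]
    exact Submodule.smul_mem _ _
      (Finsupp.supported_mono (hK k t ht i _) (ih _ (spans_omit X ht i)))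

/-- Two chain maps with a common carrier that consists of cones agree on homology. -/
theorem sub_mem_boundaries_of_carrier {X : AbstractSimplicialComplex ι}
    {Y : AbstractSimplicialComplex κ}
    {f g : ∀ k, Chains ι k →ₗ[ℤ] Chains κ k} (a : ∀ k, (Fin (k + 1) → ι) → κ)
    (K : ∀ {k : ℕ}, (Fin k → ι) → ∀ m : ℕ, Set (Fin m → κ)) (h0 : f 0 = g 0)
    (hbf : ∀ k, ∀ c ∈ chains X (k + 1), bdry k (f (k + 1) c) = f k (bdry k c))
    (hbg : ∀ k, ∀ c ∈ chains X (k + 1), bdry k (g (k + 1) c) = g k (bdry k c))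
    (hK : ∀ k (t : Fin (k + 1) → ι), Spans X t → ∀ (i : Fin (k + 1)) m,
      K (fun j : Fin k => t (i.succAbove j)) m ⊆ K t m)
    (ha : ∀ k (t : Fin (k + 1) → ι), Spans X t → ∀ m, ∀ u ∈ K t m,
      (Fin.cons (a k t) u : Fin (m + 1) → κ) ∈ K t (m + 1))
    (hf : ∀ k (t : Fin (k + 1) → ι), Spans X t →
      f (k + 1) (Finsupp.single t 1) ∈ Finsupp.supported ℤ ℤ (K t (k + 1)))
    (hg : ∀ k (t : Fin (k + 1) → ι), Spans X t →
      g (k + 1) (Finsupp.single t 1) ∈ Finsupp.supported ℤ ℤ (K t (k + 1)))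
    (hY : ∀ k (t : Fin k → ι), Spans X t → ∀ m, ∀ u ∈ K t m, Spans Y u)
    (k : ℕ) {c : Chains ι k} (hc : c ∈ cycles X k) : f k c - g k c ∈ boundaries Y k := by
  -- On a cycle the term `D∂c` vanishes, so `Dc` itself bounds `f c - g c`; by `hY` it is a chain of
  -- `Y`.
  refine ⟨coneHomotopy f g a k c, ?_, ?_⟩
  · have : chains X k ≤ (chains Y (k + 1)).comap (coneHomotopy f g a k) := by
      rw [chains_le_iff]
      intro t ht
      exact Finsupp.supported_mono (hY k t ht (k + 1))
        (coneHomotopy_mem_supported hK ha hf hg k t ht)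
    exact this (cycles_le_chains X k hc)
  · cases k with
    -- Index `0` is degree `-1`, where `f` and `g` coincide and the homotopy is zero.
    | zero => simp [coneHomotopy, h0]
    | succ k =>
      rw [bdry_coneHomotopy a h0 hbf hbg k hc.1, LinearMap.mem_ker.1 hc.2, map_zero, sub_zero]

/-! ### Barycentric subdivision is an isomorphism on homology -/

/-- Spanning depends only on the set of entries. In the first case `t` is empty, and then `u` must
be empty too. -/
theorem spans_of_range_subset {X : AbstractSimplicialComplex ι} {k m : ℕ} {t : Fin k → ι}
    (ht : Spans X t) {u : Fin m → ι} (hu : Set.range u ⊆ Set.range t) : Spans X u := by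
  obtain rfl | ⟨s, hs, hst⟩ := ht
  · refine Or.inl ?_
    by_contra hm
    obtain ⟨i, _⟩ := hu ⟨⟨0, Nat.pos_of_ne_zero hm⟩, rfl⟩
    exact i.elim0
  · refine Or.inr ⟨s, hs, fun i => ?_⟩
    obtain ⟨j, hj⟩ := hu ⟨i, rfl⟩
    exact hj ▸ hst j

theorem faces_nonempty (X : AbstractSimplicialComplex ι) (s : FacePoset X) : s.1.Nonempty :=
  (X.isRelLowerSet_faces s.2).1

/-- A chosen vertex of a simplex. -/
def someVertex (X : AbstractSimplicialComplex ι) (s : FacePoset X) : ι :=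
  (faces_nonempty X s).choose

theorem someVertex_mem (X : AbstractSimplicialComplex ι) (s : FacePoset X) :
    someVertex X s ∈ s.1 :=
  (faces_nonempty X s).choose_spec

/-- A non-empty finite set has a maximal element, and in a chain a maximal element is the greatest
one. -/
theorem exists_max_of_isChain {P : Type*} [PartialOrder P] {k : ℕ} {t : Fin (k + 1) → P}
    (ht : IsChain (· ≤ ·) (Set.range t)) : ∃ j, ∀ i, t i ≤ t j := by
  obtain ⟨m, hm⟩ := (Set.finite_range t).exists_maximal (Set.range_nonempty t)
  obtain ⟨j, rfl⟩ := hm.prop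
  refine ⟨j, fun i => ?_⟩
  obtain h | h := ht.total ⟨i, rfl⟩ ⟨j, rfl⟩
  · exact h
  · exact hm.le_of_ge ⟨i, rfl⟩ h

/-- The empty range is a chain, so the convention that the empty tuple spans agrees with the order
condition and no case `k = 0` has to be excluded. -/
theorem spans_orderComplex_iff {P : Type*} [PartialOrder P] {k : ℕ} {t : Fin k → P} :
    Spans (orderComplex P) t ↔ IsChain (· ≤ ·) (Set.range t) := by
  classical
  constructor
  · rintro (rfl | ⟨s, hs, hst⟩)
    · rw [Set.range_eq_empty]
      exact IsChain.empty
    · exact hs.2.mono (by rintro _ ⟨i, rfl⟩; exact hst i)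
  · intro h
    obtain _ | k := k
    · exact Or.inl rfl
    · refine Or.inr ⟨Finset.univ.image t, ⟨⟨t 0, Finset.mem_image_of_mem t (Finset.mem_univ 0)⟩,
        ?_⟩, fun i => Finset.mem_image_of_mem t (Finset.mem_univ i)⟩
      rwa [Finset.coe_image, Finset.coe_univ, Set.image_univ]

open Classical in
/-- The simplicial map `P(X) → X` that sends a simplex to a chosen vertex. -/
def vertexMap (X : AbstractSimplicialComplex ι) :
    SimplicialMap (orderComplex (FacePoset X)) X where
  toFun := someVertex X
  image_mem := fun s hs => by
    -- The largest simplex `m` of the flag contains the chosen vertices of all the others, so these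
    -- vertices form a face of `m`.
    obtain ⟨m, hm⟩ := s.exists_maximal hs.1
    refine ⟨s.image (someVertex X), (X.isRelLowerSet_faces m.2).2 ?_ (hs.1.image _),
      Finset.coe_image⟩
    intro x hx
    obtain ⟨u, hu, rfl⟩ := Finset.mem_image.1 hx
    have hum : u ≤ m := (hs.2.total hu hm.prop).elim id fun h => hm.le_of_ge hu h
    exact hum (someVertex_mem X u)

/-- There is only one empty tuple. This lemma and the next one provide the hypothesis `h0` in the
two carrier arguments. -/
theorem push_subdivide_zero {X : AbstractSimplicialComplex ι} (f : FacePoset X → ι)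
    (c : Chains ι 0) : push f 0 (subdivide X 0 c) = c := by
  have : (push f 0).comp (subdivide X 0) = (LinearMap.id : Chains ι 0 →ₗ[ℤ] Chains ι 0) := by
    apply chains_hom_ext
    intro t
    rw [LinearMap.comp_apply, subdivide, Finsupp.lmapDomain_apply, Finsupp.mapDomain_single,
      push_single, LinearMap.id_apply]
    congr 1
    exact Subsingleton.elim _ _
  exact LinearMap.congr_fun this c

theorem subdivide_push_zero {X : AbstractSimplicialComplex ι} (f : FacePoset X → ι)
    (c : Chains (FacePoset X) 0) : subdivide X 0 (push f 0 c) = c := by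
  have : (subdivide X 0).comp (push f 0) =
      (LinearMap.id : Chains (FacePoset X) 0 →ₗ[ℤ] Chains (FacePoset X) 0) := by
    apply chains_hom_ext
    intro t
    rw [LinearMap.comp_apply, push_single, subdivide, Finsupp.lmapDomain_apply,
      Finsupp.mapDomain_single, LinearMap.id_apply]
    congr 1
    exact Subsingleton.elim _ _
  exact LinearMap.congr_fun this c

/-- The subdivision of a tuple consists of flags of simplices whose vertices are entries of the
tuple, so the chosen vertices are again entries. The carrier is thus the set of all tuples with
entries in `Set.range t`; chosen vertices may coincide, which ordered chains permit. The apex `t 0`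
could be any other entry. -/
theorem vertexMap_subdivide_sub_mem (X : AbstractSimplicialComplex ι) (k : ℕ) {c : Chains ι k}
    (hc : c ∈ cycles X k) : push (someVertex X) k (subdivide X k c) - c ∈ boundaries X k := by
  refine sub_mem_boundaries_of_carrier (X := X) (Y := X)
    (f := fun k => (push (someVertex X) k).comp (subdivide X k)) (g := fun _ => LinearMap.id)
    (fun _ t => t 0) (fun t m => {u | Set.range u ⊆ Set.range t}) ?_ ?_ ?_ ?_ ?_ ?_ ?_ ?_ k hc
  · exact LinearMap.ext fun c => push_subdivide_zero _ c
  · intro k c hc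
    simp only [LinearMap.comp_apply]
    rw [bdry_push, bdry_subdivide X k hc]
  · intro k c _
    rfl
  · intro k t _ i m u hu
    refine Set.Subset.trans hu ?_
    rintro _ ⟨j, rfl⟩
    exact ⟨_, rfl⟩
  · intro k t _ m u hu
    rw [Set.mem_ofPred_eq, Fin.range_cons]
    exact Set.insert_subset ⟨0, rfl⟩ hu
  · intro k t ht
    have h := subdivide_mem_supported X (k + 1) t ht
    have hp : Finsupp.supported ℤ ℤ {u : Fin (k + 1) → FacePoset X |
        IsChain (· ≤ ·) (Set.range u) ∧ ∀ i, ((u i : Finset ι) : Set ι) ⊆ Set.range t} ≤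
        (Finsupp.supported ℤ ℤ {u : Fin (k + 1) → ι | Set.range u ⊆ Set.range t}).comap
          (push (someVertex X) (k + 1)) := by
      -- A chosen vertex of a simplex contained in `Set.range t` lies in `Set.range t`.
      rw [Finsupp.supported_eq_span_single, Submodule.span_le]
      rintro _ ⟨u, hu, rfl⟩
      rw [SetLike.mem_coe, Submodule.mem_comap, push_single]
      refine Finsupp.single_mem_supported ℤ _ ?_
      rintro _ ⟨i, rfl⟩
      exact hu.2 i (someVertex_mem X (u i))
    exact hp h
  · intro k t _
    exact Finsupp.single_mem_supported ℤ _ (Set.Subset.refl (Set.range t))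
  · intro k t ht m u hu
    exact spans_of_range_subset ht hu

open Classical in
/-- The largest entry of a tuple, if there is one. -/
def maxEntry {P : Type*} [PartialOrder P] (k : ℕ) (t : Fin (k + 1) → P) : P :=
  -- `coneHomotopy` needs an apex for every tuple; the fallback `t 0` is reached only when the
  -- entries do not form a chain.
  if h : ∃ j, ∀ i, t i ≤ t j then t h.choose else t 0

theorem maxEntry_spec {P : Type*} [PartialOrder P] {k : ℕ} {t : Fin (k + 1) → P}
    (ht : Spans (orderComplex P) t) : (∃ j, maxEntry k t = t j) ∧ ∀ i, t i ≤ maxEntry k t := by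
  have h := exists_max_of_isChain (spans_orderComplex_iff.1 ht)
  rw [maxEntry, dif_pos h]
  exact ⟨⟨_, rfl⟩, h.choose_spec⟩

/-- The chosen vertices of a flag `t` all lie in its largest simplex, so the subdivision of the
tuple of these vertices consists of flags of faces of that simplex. The carrier asks that every
simplex lie below some entry of `t`, a condition that is visibly inherited from faces of `t`; since
`t` is a chain, it amounts to lying below `maxEntry`. -/
theorem subdivide_vertexMap_sub_mem (X : AbstractSimplicialComplex ι) (k : ℕ)
    {c : Chains (FacePoset X) k} (hc : c ∈ cycles (orderComplex (FacePoset X)) k) :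
    subdivide X k (push (someVertex X) k c) - c ∈ boundaries (orderComplex (FacePoset X)) k := by
  refine sub_mem_boundaries_of_carrier (X := orderComplex (FacePoset X))
    (Y := orderComplex (FacePoset X))
    (f := fun k => (subdivide X k).comp (push (someVertex X) k)) (g := fun _ => LinearMap.id)
    maxEntry (fun t m => {u | IsChain (· ≤ ·) (Set.range u) ∧ ∀ i, ∃ j, u i ≤ t j})
    ?_ ?_ ?_ ?_ ?_ ?_ ?_ ?_ k hc
  · exact LinearMap.ext fun c => subdivide_push_zero _ c
  · intro k c hc
    simp only [LinearMap.comp_apply]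
    have h := bdry_subdivide X k (push_mem_chains (vertexMap X) hc)
    rw [bdry_push] at h
    exact h
  · intro k c _
    rfl
  · intro k t _ i m u hu
    refine ⟨hu.1, fun l => ?_⟩
    obtain ⟨j, hj⟩ := hu.2 l
    exact ⟨_, hj⟩
  · intro k t ht m u hu
    -- The largest entry lies above every simplex of the flag `u`, so adding it in front leaves a
    -- flag.
    obtain ⟨⟨j, hj⟩, hle⟩ := maxEntry_spec ht
    refine ⟨?_, Fin.cases ⟨j, hj.le⟩ hu.2⟩
    rw [Fin.range_cons]
    refine hu.1.insert ?_
    rintro _ ⟨i, rfl⟩ _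
    obtain ⟨l, hl⟩ := hu.2 i
    exact Or.inr (hl.trans (hle l))
  · intro k t ht
    obtain ⟨⟨j, hj⟩, hle⟩ := maxEntry_spec ht
    -- The largest entry is a simplex of `X` that contains all the chosen vertices.
    have hs : Spans X (someVertex X ∘ t) :=
      Or.inr ⟨(maxEntry k t).1, (maxEntry k t).2, fun i => hle i (someVertex_mem X (t i))⟩
    rw [LinearMap.comp_apply, push_single]
    refine Finsupp.supported_mono ?_ (subdivide_mem_supported X (k + 1) _ hs)
    rintro u ⟨hu, hut⟩
    -- Every vertex of `u i` is the chosen vertex of some `t l`, and `t l ≤ t j`.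
    refine ⟨hu, fun i => ⟨j, fun x hx => ?_⟩⟩
    obtain ⟨l, rfl⟩ := hut i hx
    exact (hj ▸ hle l) (someVertex_mem X (t l))
  · intro k t ht
    exact Finsupp.single_mem_supported ℤ _ ⟨spans_orderComplex_iff.1 ht, fun i => ⟨i, le_rfl⟩⟩
  · intro k t _ m u hu
    exact spans_orderComplex_iff.2 hu.1

/-- Barycentric subdivision induces an isomorphism on reduced homology. -/
theorem subdivision_bijective (X : AbstractSimplicialComplex ι) (k : ℕ) :
    Function.Bijective (subdivision X k) := by
  -- Classes in the quotient agree when representatives differ by a boundary, which is what the two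
  -- carrier arguments give.
  refine Function.bijective_iff_has_inverse.2 ⟨redMap (vertexMap X) k, fun x => ?_, fun x => ?_⟩
  · obtain ⟨⟨c, hc⟩, rfl⟩ := Submodule.Quotient.mk_surjective _ x
    exact (Submodule.Quotient.eq _).2 (vertexMap_subdivide_sub_mem X k hc)
  · obtain ⟨⟨c, hc⟩, rfl⟩ := Submodule.Quotient.mk_surjective _ x
    exact (Submodule.Quotient.eq _).2 (subdivide_vertexMap_sub_mem X k hc)

/-! ### Naturality -/

open Classical in
/-- The poset map `P(X) → P(Y)` induced by a simplicial map `X → Y`. -/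
def faceMap {X : AbstractSimplicialComplex ι} {Y : AbstractSimplicialComplex κ}
    (f : SimplicialMap X Y) : FacePoset X →o FacePoset Y where
  toFun s := ⟨s.1.image f.toFun, by
    obtain ⟨t, ht, hts⟩ := f.image_mem s.1 s.2
    rw [← Finset.coe_image, Finset.coe_inj] at hts
    exact hts ▸ ht⟩
  monotone' := fun _ _ h => Finset.image_subset_image h

theorem push_cone (f : ι → κ) (a : ι) (k : ℕ) (c : Chains ι k) :
    push f (k + 1) (cone a k c) = cone (f a) k (push f k c) := by
  have h : (push f (k + 1)).comp (cone a k) = (cone (f a) k).comp (push f k) := by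
    apply chains_hom_ext
    intro t
    rw [LinearMap.comp_apply, LinearMap.comp_apply, cone_single, push_single, push_single,
      cone_single, Fin.comp_cons]
  exact LinearMap.congr_fun h c

/-- The recursion for subdivision is respected on the nose: the barycenter of a simplex goes to the
barycenter of its image, and cones and boundaries commute with `push`. Collapsed vertices do no
harm, as `spanSimplex` only sees the set of entries. The restriction to `chains X` matters because
`subdivide X` kills non-spanning tuples, whose images may span in `Y`. -/
theorem subdivide_push {X : AbstractSimplicialComplex ι} {Y : AbstractSimplicialComplex κ}
    (f : SimplicialMap X Y) (k : ℕ) {c : Chains ι k} (hc : c ∈ chains X k) :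
    subdivide Y k (push f.toFun k c) = push (faceMap f) k (subdivide X k c) := by
  classical
  have : chains X k ≤ LinearMap.eqLocus ((subdivide Y k).comp (push f.toFun k))
      ((push (faceMap f) k).comp (subdivide X k)) := by
    clear hc c
    rw [chains_le_iff]
    intro t ht
    rw [LinearMap.mem_eqLocus, LinearMap.comp_apply, LinearMap.comp_apply]
    induction k with
    | zero =>
      rw [push_single, subdivide, subdivide, Finsupp.lmapDomain_apply, Finsupp.lmapDomain_apply,
        Finsupp.mapDomain_single, Finsupp.mapDomain_single, push_single]
      congr 1
      exact Subsingleton.elim _ _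
    | succ k ih =>
      -- The induction hypothesis concerns single tuples; it is needed on the boundary of `t`, a
      -- combination of them.
      have hle : chains X k ≤ LinearMap.eqLocus ((subdivide Y k).comp (push f.toFun k))
          ((push (faceMap f) k).comp (subdivide X k)) := (chains_le_iff X).2 ih
      have hft : Spans Y (f.toFun ∘ t) := by
        obtain h | ⟨s, hs, hst⟩ := ht
        · omega
        · exact Or.inr ⟨_, (faceMap f ⟨s, hs⟩).2, fun i => Finset.mem_image_of_mem _ (hst i)⟩
      have hspan : spanSimplex Y (f.toFun ∘ t) hft = faceMap f (spanSimplex X t ht) := by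
        apply Subtype.ext
        ext x
        change x ∈ Finset.univ.image (f.toFun ∘ t) ↔ x ∈ (Finset.univ.image t).image f.toFun
        simp
      have hb : subdivide Y k (push f.toFun k (bdry k (Finsupp.single t 1))) =
          push (faceMap f) k (subdivide X k (bdry k (Finsupp.single t 1))) :=
        hle (bdry_mem_chains X (single_mem_chains X ht 1))
      rw [push_single, subdivide_single Y hft, subdivide_single X ht, push_cone, ← hb,
        ← bdry_push, push_single, hspan]
  exact this hc

theorem subdivision_redMap {X : AbstractSimplicialComplex ι} {Y : AbstractSimplicialComplex κ}
    (f : SimplicialMap X Y) (k : ℕ) (x : RedHomology X k) :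
    subdivision Y k (redMap f k x) =
      redMap (orderComplexMap (faceMap f)) k (subdivision X k x) := by
  obtain ⟨⟨c, hc⟩, rfl⟩ := Submodule.Quotient.mk_surjective _ x
  exact congrArg Submodule.Quotient.mk
    (Subtype.ext (subdivide_push f k (cycles_le_chains X k hc)))

/-- `connecting` takes the boundary of a representative and `push` commutes with `bdry`, so the two
sides already agree on representatives. -/
theorem connecting_relMap {X A : AbstractSimplicialComplex ι} {Y B : AbstractSimplicialComplex κ}
    (f : SimplicialMap X Y) (g : SimplicialMap A B) (hfg : g.toFun = f.toFun) (n : ℕ)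
    (x : RelHomology X A n) :
    connecting Y B n (relMap f g hfg n x) = redMap g n (connecting X A n x) := by
  obtain ⟨⟨c, hc⟩, rfl⟩ := Submodule.Quotient.mk_surjective _ x
  refine congrArg Submodule.Quotient.mk (Subtype.ext ?_)
  change bdry n (push f.toFun (n + 1) c) = push g.toFun n (bdry n c)
  rw [bdry_push, hfg]

theorem redMap_orderComplexMap_comp {P Q R : Type*} [PartialOrder P] [PartialOrder Q]
    [PartialOrder R] (f : P →o Q) (g : Q →o R) (k : ℕ) (x : RedHomology (orderComplex P) k) :
    redMap (orderComplexMap g) k (redMap (orderComplexMap f) k x) =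
      redMap (orderComplexMap (g.comp f)) k x := by
  obtain ⟨⟨c, hc⟩, rfl⟩ := Submodule.Quotient.mk_surjective _ x
  refine congrArg Submodule.Quotient.mk (Subtype.ext ?_)
  change push g k (push f k c) = push (g ∘ f) k c
  have h : (push g k).comp (push f k) = push (g ∘ f) k := by
    apply chains_hom_ext
    intro t
    rw [LinearMap.comp_apply, push_single, push_single, push_single]
    rfl
  exact LinearMap.congr_fun h c

end

/-! ### Rational spans of columns, and maps out of the group ring -/

section
variable {n : ℕ}

/-- `ratSpan` is defined from all integral points of `lineSpan s`. Since `toRat` is additive and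
turns integral multiples into rational ones, any integral generating set suffices, which allows a
comparison with the columns of a matrix. -/
theorem ratSpan_eq_span {s : Finset (Line n)} {S : Set (SymIdx n → ℤ)}
    (h : lineSpan s = Submodule.span ℤ S) : ratSpan s = Submodule.span ℚ (toRat '' S) := by
  rw [ratSpan, h]
  refine le_antisymm (Submodule.span_le.2 ?_)
    (Submodule.span_mono (Set.image_mono Submodule.subset_span))
  rintro _ ⟨x, hx, rfl⟩
  induction hx using Submodule.span_induction with
  | mem x hx => exact Submodule.subset_span ⟨x, hx, rfl⟩
  | zero =>
    have : toRat (0 : SymIdx n → ℤ) = 0 := by funext a; simp [toRat]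
    rw [this]
    exact Submodule.zero_mem _
  | add x y _ _ hx hy =>
    have : toRat (x + y) = toRat x + toRat y := by funext a; simp [toRat]
    rw [this]
    exact Submodule.add_mem _ hx hy
  | smul m x _ hx =>
    have : toRat (m • x) = (m : ℚ) • toRat x := by funext a; simp [toRat]
    rw [this]
    exact Submodule.smul_mem _ _ hx

/-- The geometric core of the factorization: the apartment of `M` is its sphere in `I^δ_n` followed
by the spanning map. The lines `⟨M_a⟩_ℤ` are by definition spanned by the columns, so both maps send
`I` to the rational span of the same vectors. -/
theorem spanPosetMap_comp_faceMap (M : Sp n) :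
    (spanPosetMap n).comp (faceMap (sphereMap M)) = apartmentMap M := by
  classical
  refine OrderHom.ext _ _ (funext fun I => Subtype.ext ?_)
  change ratSpan (I.1.image (columnLine M)) = _
  have h : lineSpan (I.1.image (columnLine M)) =
      Submodule.span ℤ (column M '' (I.1 : Set (SymIdx n))) := by
    rw [lineSpan, Finset.iSup_finset_image, Set.image_eq_iUnion, Submodule.span_iUnion₂]
    rfl
  rw [ratSpan_eq_span h, Set.image_image]
  rfl

theorem extendLinearly_single {A : Type*} [AddCommGroup A] (f : Sp n → A) (M : Sp n) :
    extendLinearly f (MonoidAlgebra.single M 1) = f M := by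
  simp [extendLinearly]

theorem groupRing_hom_ext {A : Type*} [AddCommGroup A]
    {f g : MonoidAlgebra ℤ (Sp n) →ₗ[ℤ] A}
    (h : ∀ M, f (MonoidAlgebra.single M 1) = g (MonoidAlgebra.single M 1)) : f = g :=
  MonoidAlgebra.lhom_ext' fun M => LinearMap.ext_ring (h M)

end

end SymplecticApartments

end

/-! ### The factorization of the apartment class map -/

theorem proposition5p1 (n : ℕ) (hn : 1 ≤ n) (ξ₀ : RedHomology (bdryBeta 1) 1)
    (hξ₀ : Submodule.span ℤ {ξ₀} = ⊤) :
    Function.Bijective (subdivision (IDelta n) n) ∧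
      apartmentClassMap n ξ₀ =
        spanMap n ∘ₗ subdivision (IDelta n) n ∘ₗ connecting (IA n) (IDelta n) n ∘ₗ
          alpha n hn ξ₀ := by
  refine ⟨subdivision_bijective (IDelta n) n, groupRing_hom_ext fun M => ?_⟩
  -- The defining property of the fundamental class of the disc: its boundary is `ξ`.
  have hconn : connecting (beta n) (bdryBeta n) n
      ((connectingBeta n hn).symm (fundamentalClass ξ₀ n)) = fundamentalClass ξ₀ n :=
    (connectingBeta n hn).apply_symm_apply _
  -- Taking the boundary before mapping replaces the disc in `IA_n` by its bounding sphere in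
  -- `I^δ_n`.
  have hδα : connecting (IA n) (IDelta n) n (alpha n hn ξ₀ (MonoidAlgebra.single M 1)) =
      redMap (sphereMap M) n (fundamentalClass ξ₀ n) := by
    rw [alpha, extendLinearly_single]
    exact (connecting_relMap (discMap M) (sphereMap M) rfl n _).trans
      (congrArg (redMap (sphereMap M) n) hconn)
  simp only [LinearMap.comp_apply]
  -- With `b` moved to `∂β_n`, the two poset maps compose to `apartmentMap M`, and both sides are
  -- its value on `b(ξ)`.
  rw [apartmentClassMap, extendLinearly_single, hδα, subdivision_redMap, spanMap,
    redMap_orderComplexMap_comp, spanPosetMap_comp_faceMap]
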